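/- Let $\mathbb F_2(D)$ be the field of binary rational functions. A Pauli sequence on $q$ qubits per frame is represented by a row vector $[z(D)\,|\,x(D)]\in\mathbb F_2(D)^{2q}$ (the coefficient of $D^t$ describes frame $t$). Let $H(D)=[Z(D)\,|\,X(D)]$ be an $(n-k)\times 2n$ quantum check matrix over $\mathbb F_2(D)$ with linearly independent rows, and suppose that its shifted symplectic product matrix has the standard form $$Z(D)X^T(D^{-1})+X(D)Z^T(D^{-1})=\bigoplus_{i=1}^{c}J\;\oplus\;\bigoplus_{j=1}^{a}[0],\qquad J=\begin{bmatrix}0&1\\1&0\end{bmatrix},\qquad a=n-k-2c .$$ *Operations.* The finite-depth gates of the shift-invariant Clifford group, applied in every frame, are: the Hadamard gate on qubit $i$ (exchanges columns $Z_i$ and $X_i$); the phase gate (adds $X_i$ to $Z_i$); the CNOT from qubit $i$ to qubit $j\ne i$ of the frame delayed by $m\in\mathbb Z$ (adds $D^mX_i$ to $X_j$ and $D^{-m}Z_j$ to $Z_i$); the controlled-phase gate from $i$ to $j\neq i$ delayed by $m$ (adds $D^mX_i$ to $Z_j$ and $D^{-m}X_j$ to $Z_i$); and the controlled-phase gate from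 qubit $i$ to itself delayed by $m\ne0$ (adds $(D^m+D^{-m})X_i$ to $Z_i$). The infinite-depth operation on qubit $i$ for a nonzero Laurent polynomial $f$ multiplies $X_i$ by $1/f(D)$ and $Z_i$ by $f(D^{-1})$. A circuit is a finite sequence of such operations. It is online if, up to a finite delay of all its outputs, it can be run frame by frame with finitely many memory qubits: one fixed Clifford operation is applied in each step to the memory and the incoming frame and yields the outgoing frame and the new memory. *Claim.* Then $k+c\ge 0$ and $n=c+a+(k+c)$, and Alice's $n$ qubits per frame can be split into her halves of $c$ ebits shared with Bob, $a$ ancilla qubits and $k+c$ information qubits, in such a way that the following holds. Let $S_0$ be the stabilizer matrix, on Bob's $c$ and Alice's $n$ qubits, with rows $Z^AZ^B$ and $X^AX^B$ for each ebit and $Z$ for each ancilla, and let $L_0$ be the matrix whose rows are the operators $Z$ and $X$ of the information qubits. There are 1. an online encoding circuit on Alice's $n$ qubits only, made of finite-depth and infinite-depth operations, with matrix $E(D)$, such that the part of the encoded stabilizer matrix $S_0E(D)$ on the $n$ qubits sent over the channel equals $R(D)H(D)$ for an invertible matrix $R(D)$ over $\mathbb F_2(D)$, so that the code has error-correcting properties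 equivalent to those of $H(D)$; and 2. an online decoding circuit on the $n$ received qubits and Bob's $c$ qubits, made of finite-depth operations only, with matrix $F(D)$, which returns the information qubits: $L_0E(D)F(D)=L_0+Q(D)\,S_0E(D)F(D)$ for a matrix $Q(D)$ of Laurent polynomials, i.e. the logical operators of the information qubits reappear in their original form up to stabilizer elements. Thus the code encodes $k+c$ information qubits per frame with the help of $c$ ebits and $a=n-k-2c$ ancilla qubits. -/

import Mathlib

open Matrix

noncomputable section

namespace EAQCC

/-- The field `F₂(D)` of rational functions in the delay operator `D`. -/
abbrev K : Type := RatFunc (ZMod 2)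

/-- The delay operator `D`. -/
abbrev D : K := RatFunc.X

theorem transcendental_D_inv : Transcendental (ZMod 2) (D⁻¹ : K) := fun h =>
  RatFunc.transcendental_X (K := ZMod 2) (IsAlgebraic.inv_iff.mp h)

/-- The substitution `f(D) ↦ f(D⁻¹)` on `F₂(D)`. -/
def bar : K →ₐ[ZMod 2] K :=
  RatFunc.liftAlgHom (Polynomial.aeval (D⁻¹ : K))
    (nonZeroDivisors_le_comap_nonZeroDivisors_of_injective _
      (transcendental_iff_injective.mp transcendental_D_inv))

/-- `f` is a Laurent polynomial in `D` (it represents a finite-weight sequence). -/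
def IsLaurent (f : K) : Prop :=
  ∃ (p : Polynomial (ZMod 2)) (m : ℕ), f = algebraMap (Polynomial (ZMod 2)) K p / D ^ m

/-! Pauli sequences on a set `q` of qubits per frame are row vectors `[z(D) | x(D)]` indexed by
`q ⊕ q`, the summand `Sum.inl` being the `Z` side and `Sum.inr` the `X` side. -/

/-- The shifted symplectic product matrix
`Ω(D) = Z(D) Xᵀ(D⁻¹) + X(D) Zᵀ(D⁻¹)` of a check matrix `H(D) = [Z(D) | X(D)]`. -/
def shiftedSymplectic {r q : Type} [Fintype q] (H : Matrix r (q ⊕ q) K) : Matrix r r K :=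
  H.toCols₁ * (H.toCols₂.map bar)ᵀ + H.toCols₂ * (H.toCols₁.map bar)ᵀ

/-- Labels of `2c + a` generators: `c` pairs, followed by `a` single generators. -/
abbrev Gen (c a : ℕ) : Type := (Fin 2 × Fin c) ⊕ Fin a

/-- The standard form `J ⊕ ⋯ ⊕ J ⊕ [0] ⊕ ⋯ ⊕ [0]` with `c` blocks `J` and `a` blocks `[0]`. -/
def standardForm (c a : ℕ) : Matrix (Gen c a) (Gen c a) K :=
  fromBlocks (blockDiagonal fun _ : Fin c => !![0, 1; 1, 0]) 0 0 0

section Gates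

variable {q q' : Type}

/-- Elementary finite-depth shift-invariant Clifford gates; each is applied in every frame.
`cnot i j _ m` and `cphase i j _ m` act from qubit `i` of a frame to qubit `j` of the frame delayed
by `m`; `selfCphase i m _` is the controlled-phase gate between qubit `i` of a frame and
qubit `i` of the frame delayed by `m`. -/
inductive FiniteDepthGate (q : Type) : Type
  | hadamard (i : q)
  | phase (i : q)
  | cnot (i j : q) (hij : i ≠ j) (m : ℤ)
  | cphase (i j : q) (hij : i ≠ j) (m : ℤ)
  | selfCphase (i : q) (m : ℤ) (hm : m ≠ 0)

/-- Elementary shift-invariant Clifford gates: the finite-depth ones, and the infinite-depth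
operation on qubit `i` that implements `1 / f(D)` for a nonzero Laurent polynomial `f`. -/
inductive Gate (q : Type) : Type
  | finiteDepth (g : FiniteDepthGate q)
  | infiniteDepth (i : q) (f : K) (hf : IsLaurent f) (hf0 : f ≠ 0)

/-- Apply a gate on the qubits `q` to the corresponding ones among the qubits `q'`. -/
def FiniteDepthGate.map (e : q ↪ q') : FiniteDepthGate q → FiniteDepthGate q'
  | .hadamard i => .hadamard (e i)
  | .phase i => .phase (e i)
  | .cnot i j hij m => .cnot (e i) (e j) (e.injective.ne hij) m
  | .cphase i j hij m => .cphase (e i) (e j) (e.injective.ne hij) m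
  | .selfCphase i m hm => .selfCphase (e i) m hm

/-- Apply a gate on the qubits `q` to the corresponding ones among the qubits `q'`. -/
def Gate.map (e : q ↪ q') : Gate q → Gate q'
  | .finiteDepth g => .finiteDepth (g.map e)
  | .infiniteDepth i f hf hf0 => .infiniteDepth (e i) f hf hf0

variable [DecidableEq q]

/-- The matrix by which a finite-depth gate multiplies row vectors `[z(D) | x(D)]` on the right. -/
def FiniteDepthGate.toMatrix : FiniteDepthGate q → Matrix (q ⊕ q) (q ⊕ q) K
  -- exchanges the columns `Z_i` and `X_i`
  | .hadamard i => (1 : Matrix (q ⊕ q) (q ⊕ q) K).submatrix id (Equiv.swap (.inl i) (.inr i))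
  -- adds column `X_i` to column `Z_i`
  | .phase i => 1 + single (.inr i) (.inl i) 1
  -- adds `D ^ m` times `X_i` to `X_j`, and `D ^ (-m)` times `Z_j` to `Z_i`
  | .cnot i j _ m => 1 + single (.inr i) (.inr j) (D ^ m) + single (.inl j) (.inl i) (D ^ (-m))
  -- adds `D ^ m` times `X_i` to `Z_j`, and `D ^ (-m)` times `X_j` to `Z_i`
  | .cphase i j _ m => 1 + single (.inr i) (.inl j) (D ^ m) + single (.inr j) (.inl i) (D ^ (-m))
  -- adds `D ^ m + D ^ (-m)` times `X_i` to `Z_i`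
  | .selfCphase i m _ => 1 + single (.inr i) (.inl i) (D ^ m + D ^ (-m))

/-- The matrix by which a gate multiplies row vectors `[z(D) | x(D)]` on the right. The
infinite-depth operation multiplies column `X_i` by `1 / f(D)` and column `Z_i` by `f(D⁻¹)`. -/
def Gate.toMatrix : Gate q → Matrix (q ⊕ q) (q ⊕ q) K
  | .finiteDepth g => g.toMatrix
  | .infiniteDepth i f _ _ =>
      diagonal (Sum.elim (Function.update 1 i (bar f)) (Function.update 1 i f⁻¹))

variable [Fintype q]

/-- The action of a circuit, its gates being applied in the order of the list. -/
def circuitMatrix (gs : List (Gate q)) : Matrix (q ⊕ q) (q ⊕ q) K :=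
  (gs.map Gate.toMatrix).prod

/-- A Pauli sequence on the `μ` memory qubits together with one on the qubits `q`. -/
def withMemory {μ : ℕ} (w : Fin μ ⊕ Fin μ → K) (v : q ⊕ q → K) :
    (Fin μ ⊕ q) ⊕ (Fin μ ⊕ q) → K :=
  Sum.elim (Sum.elim (w ∘ .inl) (v ∘ .inl)) (Sum.elim (w ∘ .inr) (v ∘ .inr))

/-- A circuit with action `M` can be run online: frame by frame, with finitely many memory
qubits and a finite latency `d`. In every time step one and the same Clifford operation `U`
(a symplectic matrix over `F₂`) takes the memory left by the preceding step and the incoming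
frame to the outgoing frame and the new memory. If `w(D)` is the sequence of memory contents after
each step, then `D w(D)` is the sequence of those before each step. -/
def IsOnline (M : Matrix (q ⊕ q) (q ⊕ q) K) : Prop :=
  ∃ (μ d : ℕ) (U : Matrix ((Fin μ ⊕ q) ⊕ (Fin μ ⊕ q)) ((Fin μ ⊕ q) ⊕ (Fin μ ⊕ q)) (ZMod 2)),
    U ∈ symplecticGroup (Fin μ ⊕ q) (ZMod 2) ∧
    ∀ v : q ⊕ q → K, ∃ w : Fin μ ⊕ Fin μ → K,
      withMemory (D • w) v ᵥ* U.map (algebraMap (ZMod 2) K) = withMemory w (D ^ d • (v ᵥ* M))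

end Gates

section Code

variable {n c a m : ℕ}

/-- The qubits of a frame: Bob's halves of the `c` ebits, and Alice's `n` qubits, which she
sends over the channel. -/
abbrev Qubits (c n : ℕ) : Type := Fin c ⊕ Fin n

/-- The Pauli operator `Z` on qubit `i` of frame `0`. -/
def pauliZ {q : Type} [DecidableEq q] (i : q) : q ⊕ q → K := Pi.single (.inl i) 1

/-- The Pauli operator `X` on qubit `i` of frame `0`. -/
def pauliX {q : Type} [DecidableEq q] (i : q) : q ⊕ q → K := Pi.single (.inr i) 1

/-- The stabilizer matrix before encoding: `Z ⊗ Z` and `X ⊗ X` on each of `c` ebits, and `Z` on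
each of `a` ancillas. The bijection `e` says which of Alice's `n` qubits are her halves of the
ebits, which are ancillas, and which are information qubits. -/
def initialStabilizer (e : Fin c ⊕ Fin a ⊕ Fin m ≃ Fin n) :
    Matrix (Gen c a) (Qubits c n ⊕ Qubits c n) K :=
  Matrix.of <| Sum.elim
    (fun p => if p.1 = 0
      then pauliZ (.inl p.2) + pauliZ (.inr (e (.inl p.2)))
      else pauliX (.inl p.2) + pauliX (.inr (e (.inl p.2))))
    (fun j => pauliZ (.inr (e (.inr (.inl j)))))

/-- The information-qubit matrix before encoding: the operators `Z` and `X` on each of the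
`m` information qubits. -/
def initialInfo (e : Fin c ⊕ Fin a ⊕ Fin m ≃ Fin n) :
    Matrix (Fin 2 × Fin m) (Qubits c n ⊕ Qubits c n) K :=
  Matrix.of fun p => if p.1 = 0
    then pauliZ (.inr (e (.inr (.inr p.2)))) else pauliX (.inr (e (.inr (.inr p.2))))

/-- The part of a check matrix on the `n` qubits sent over the channel. -/
def channelPart {r : Type} (S : Matrix r (Qubits c n ⊕ Qubits c n) K) :
    Matrix r (Fin n ⊕ Fin n) K :=
  S.submatrix id (Sum.map .inr .inr)

/-- Two check matrices have equivalent error-correcting properties: they differ by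
(invertible) row operations with rational coefficients. -/
def RowEquivalent {r q : Type} [Fintype r] [DecidableEq r] (A B : Matrix r (q ⊕ q) K) : Prop :=
  ∃ R : Matrix r r K, IsUnit R.det ∧ A = R * B

/-- The action of Alice's circuit on all qubits: it does not touch Bob's qubits. -/
def encoderMatrix (c : ℕ) (enc : List (Gate (Fin n))) :
    Matrix (Qubits c n ⊕ Qubits c n) (Qubits c n ⊕ Qubits c n) K :=
  circuitMatrix (enc.map (Gate.map Function.Embedding.inr))

/-- The action of Bob's finite-depth circuit on all qubits. -/
def decoderMatrix (dec : List (FiniteDepthGate (Qubits c n))) :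
    Matrix (Qubits c n ⊕ Qubits c n) (Qubits c n ⊕ Qubits c n) K :=
  circuitMatrix (dec.map Gate.finiteDepth)

/-- The encoder `E` followed by the decoder `F` returns the information qubits: their logical
operators take their original form again, up to products of (finitely many shifts of)
stabilizer generators. -/
def Decodes (e : Fin c ⊕ Fin a ⊕ Fin m ≃ Fin n)
    (E F : Matrix (Qubits c n ⊕ Qubits c n) (Qubits c n ⊕ Qubits c n) K) : Prop :=
  ∃ Q : Matrix (Fin 2 × Fin m) (Gen c a) K, (∀ i j, IsLaurent (Q i j)) ∧
    initialInfo e * E * F = initialInfo e + Q * (initialStabilizer e * E * F)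

end Code

end EAQCC

end

noncomputable section

namespace EAQCC

/-! Over the field `K` the shifted symplectic product `sform` is Hermitian with respect to `bar`,
and finite-depth gates are isometries of it. They act on row vectors as elementary column operations
with monomial coefficients, so Euclidean division of Laurent polynomials, measured by `spread`,
takes any nonzero isotropic vector to a multiple of a single `Z` (`exists_circuit_of_isotropic`).
Iterating this as in Gram–Schmidt (`exists_circuit_prefix`), a finite-depth circuit `gs` straightens
the span of the isolated rows of `H` and of one row from each symplectic pair: it becomes the span
of `Z` on `a` ancilla and `c` ebit qubits. By nondegeneracy the partner rows can then be normalized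
to vectors `y i` which have the X part of `X` on the `i`-th ebit and no X part on the ancillas
(`exists_circuit_normal_form`). Their Z parts on ebits and ancillas are irrelevant, because those
`Z` lie in the row space already; what remains is a rational tail on the information qubits.

The encoder builds these vectors from the ebits. For a common denominator `h` of the tails, a
finite-depth shear from ebits to information qubits creates `h` times each tail, an infinite-depth
operation on Alice's halves scales `X` by `h`, and the reverse of `gs` restores the row space of
`H`. The shear alters an information operator only by `Z` on Alice's halves. Multiplication by
encoded generators `Z ⊗ Z` moves this change to Bob's halves, which were never scaled. Bob can
therefore apply `gs` and undo the shear with his own halves as controls, and never has to invert the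
infinite-depth operation (`exists_encoder_decoder`).

Online realizability holds gate by gate: memory qubits give delays, feedback through memory gives
division by a polynomial, and the class is closed under composition (`isOnline_circuitMatrix`). -/

theorem D_ne_zero : (D : K) ≠ 0 := RatFunc.X_ne_zero

/-! ### The involution `D ↦ D⁻¹` -/

@[simp]
theorem bar_D : bar D = D⁻¹ := by
  have h := RatFunc.liftAlgHom_apply_div' (S := ZMod 2) (L := K)
    (φ := Polynomial.aeval (D⁻¹ : K))
    (nonZeroDivisors_le_comap_nonZeroDivisors_of_injective _
      (transcendental_iff_injective.mp transcendental_D_inv)) Polynomial.X 1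
  simpa [bar] using h

theorem bar_algebraMap (p : Polynomial (ZMod 2)) :
    bar (algebraMap _ K p) = Polynomial.aeval (D⁻¹ : K) p := by
  have h := RatFunc.liftAlgHom_apply_div' (S := ZMod 2) (L := K)
    (φ := Polynomial.aeval (D⁻¹ : K))
    (nonZeroDivisors_le_comap_nonZeroDivisors_of_injective _
      (transcendental_iff_injective.mp transcendental_D_inv)) p 1
  simpa [bar] using h

theorem algebraMap_eq_aeval (p : Polynomial (ZMod 2)) :
    algebraMap _ K p = Polynomial.aeval (D : K) p := by
  change _ = Polynomial.aeval (RatFunc.X : K) p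
  rw [← RatFunc.algebraMap_X, Polynomial.aeval_algebraMap_apply, Polynomial.aeval_X_left_apply]

@[simp]
theorem bar_bar (f : K) : bar (bar f) = f := by
  induction f using RatFunc.induction_on with
  | f p q hq =>
    have key : ∀ p : Polynomial (ZMod 2), bar (bar (algebraMap _ K p)) = algebraMap _ K p := by
      intro p
      rw [bar_algebraMap, ← Polynomial.aeval_algHom_apply, map_inv₀, bar_D, inv_inv,
        algebraMap_eq_aeval]
    rw [map_div₀, map_div₀, key, key]

theorem bar_injective : Function.Injective bar := Function.LeftInverse.injective bar_bar

@[simp]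
theorem bar_eq_zero {f : K} : bar f = 0 ↔ f = 0 := map_eq_zero_iff _ bar_injective

theorem add_self (f : K) : f + f = 0 := CharTwo.add_self_eq_zero f

/-! ### Laurent polynomials -/

namespace IsLaurent

variable {f g : K}

theorem of_polynomial (p : Polynomial (ZMod 2)) : IsLaurent (algebraMap _ K p) := ⟨p, 0, by simp⟩

theorem zero : IsLaurent 0 := ⟨0, 0, by simp⟩

theorem one : IsLaurent 1 := ⟨1, 0, by simp⟩

theorem add (hf : IsLaurent f) (hg : IsLaurent g) : IsLaurent (f + g) := by
  obtain ⟨p, m, rfl⟩ := hf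
  obtain ⟨q, l, rfl⟩ := hg
  refine ⟨p * Polynomial.X ^ l + Polynomial.X ^ m * q, m + l, ?_⟩
  have := D_ne_zero
  rw [div_add_div _ _ (pow_ne_zero _ this) (pow_ne_zero _ this), pow_add]
  simp [RatFunc.algebraMap_X]

theorem mul (hf : IsLaurent f) (hg : IsLaurent g) : IsLaurent (f * g) := by
  obtain ⟨p, m, rfl⟩ := hf
  obtain ⟨q, l, rfl⟩ := hg
  exact ⟨p * q, m + l, by rw [div_mul_div_comm, pow_add, map_mul]⟩

theorem zpow (m : ℤ) : IsLaurent (D ^ m) := by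
  obtain ⟨n, rfl | rfl⟩ := m.eq_nat_or_neg
  · exact ⟨Polynomial.X ^ n, 0, by simp [RatFunc.algebraMap_X]⟩
  · exact ⟨1, n, by simp⟩

theorem sum {ι : Type*} {s : Finset ι} {F : ι → K} (h : ∀ i ∈ s, IsLaurent (F i)) :
    IsLaurent (∑ i ∈ s, F i) := by
  classical
  induction s using Finset.induction_on with
  | empty => simpa using zero
  | insert a s ha ih =>
    rw [Finset.sum_insert ha]
    exact (h _ (by simp)).add (ih fun i hi => h i (by simp [hi]))

/-- Laurent polynomials are sums of powers of `D`. -/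
theorem induction {P : K → Prop} (h0 : P 0) (hadd : ∀ f g, P f → P g → P (f + g))
    (hpow : ∀ m : ℤ, P (D ^ m)) (hf : IsLaurent f) : P f := by
  obtain ⟨p, m, rfl⟩ := hf
  induction p using Polynomial.induction_on' with
  | add p q hp hq => rw [map_add, add_div]; exact hadd _ _ hp hq
  | monomial n b =>
    obtain rfl | rfl : b = 0 ∨ b = 1 := by revert b; decide
    · simpa using h0
    · have := hpow (n - m)
      rw [zpow_sub₀ D_ne_zero] at this
      simpa [← Polynomial.X_pow_eq_monomial, RatFunc.algebraMap_X] using this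

theorem bar (hf : IsLaurent f) : IsLaurent (bar f) := by
  refine induction (P := fun f => IsLaurent (EAQCC.bar f)) ?_ ?_ ?_ hf
  · simpa using zero
  · intro f g hf hg
    rw [map_add]
    exact hf.add hg
  · intro m
    rw [map_zpow₀, bar_D, _root_.inv_zpow, ← _root_.zpow_neg]
    exact zpow _

end IsLaurent

theorem exists_common_denominator {ι : Type*} [Finite ι] (F : ι → K) :
    ∃ s : K, s ≠ 0 ∧ IsLaurent s ∧ ∀ i, IsLaurent (s * F i) := by
  obtain ⟨b, hb⟩ := IsLocalization.exist_integer_multiples_of_finite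
    (nonZeroDivisors (Polynomial (ZMod 2))) F
  refine ⟨algebraMap _ K b.1, ?_, .of_polynomial _, fun i => ?_⟩
  · simp
  · obtain ⟨p, hp⟩ := hb i
    rw [← Algebra.smul_def, ← hp]
    exact .of_polynomial p

/-! ### The spread of a Laurent polynomial -/

/-- Over `F₂` every nonzero leading coefficient is `1`, so leading terms of equal degree cancel;
cross-multiplying by the denominators reduces this to polynomials. -/
theorem intDegree_add_lt {f g : K} (hf : f ≠ 0) (hg : g ≠ 0) (h : f.intDegree = g.intDegree)
    (hfg : f + g ≠ 0) : (f + g).intDegree < f.intDegree := by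
  have hp := mul_ne_zero (RatFunc.num_ne_zero hf) g.denom_ne_zero
  have hq := mul_ne_zero f.denom_ne_zero (RatFunc.num_ne_zero hg)
  have h2 := RatFunc.natDegree_num_mul_right_sub_natDegree_denom_mul_left_eq_intDegree hf
    g.denom_ne_zero
  have h3 := RatFunc.natDegree_num_mul_right_sub_natDegree_denom_mul_left_eq_intDegree hg
    f.denom_ne_zero
  have hs : f.num * g.denom + f.denom * g.num ≠ 0 :=
    RatFunc.num_mul_denom_add_denom_mul_num_ne_zero hfg
  rw [RatFunc.intDegree_add hfg, ← h2]
  have hlc : ∀ p : Polynomial (ZMod 2), p ≠ 0 → p.leadingCoeff = 1 := by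
    intro p hp
    have := Polynomial.leadingCoeff_ne_zero.mpr hp
    generalize p.leadingCoeff = b at this ⊢
    revert b; decide
  have hdeg : (f.num * g.denom).degree = (f.denom * g.num).degree := by
    rw [Polynomial.degree_eq_natDegree hp, Polynomial.degree_eq_natDegree hq]
    rw [mul_comm g.denom, mul_comm f.denom g.num] at *
    norm_cast
    omega
  have := Polynomial.degree_sub_lt_left hdeg hp (by rw [hlc _ hp, hlc _ hq])
  rw [CharTwo.sub_eq_add] at this
  have := Polynomial.natDegree_lt_natDegree hs this
  rw [mul_comm g.denom]
  omega

open Classical in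
/-- The number of coefficients of a Laurent polynomial between its lowest and highest terms. -/
def spread (f : K) : ℕ := if f = 0 then 0 else (f.intDegree + (bar f).intDegree + 1).toNat

@[simp]
theorem spread_zero : spread 0 = 0 := by simp [spread]

theorem intDegree_pow (f : K) (hf : f ≠ 0) (n : ℕ) : (f ^ n).intDegree = n * f.intDegree := by
  induction n with
  | zero => simp
  | succ n ih =>
    rw [pow_succ, RatFunc.intDegree_mul (pow_ne_zero _ hf) hf, ih]; push_cast; ring

theorem intDegree_D_zpow (m : ℤ) : (D ^ m : K).intDegree = m := by
  obtain ⟨n, rfl | rfl⟩ := m.eq_nat_or_neg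
  · simp [intDegree_pow _ D_ne_zero, RatFunc.intDegree_X]
  · simp [intDegree_pow _ D_ne_zero, RatFunc.intDegree_X, RatFunc.intDegree_inv]

/-- The image of `p` under `bar` is the reversed polynomial divided by `D ^ p.natDegree`, and a
polynomial has nonnegative degree. -/
theorem neg_natDegree_le_intDegree_aeval (p : Polynomial (ZMod 2)) (hp : p ≠ 0) :
    -(p.natDegree : ℤ) ≤ (bar (algebraMap _ K p)).intDegree := by
  have h : bar (algebraMap _ K p) = algebraMap _ K p.reverse * D ^ (-(p.natDegree : ℤ)) := by
    rw [bar_algebraMap, algebraMap_eq_aeval, _root_.zpow_neg, zpow_natCast,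
      ← div_eq_mul_inv, eq_div_iff (pow_ne_zero _ D_ne_zero)]
    let _ : Invertible (D⁻¹ : K) := invertibleOfNonzero (inv_ne_zero D_ne_zero)
    have := Polynomial.eval₂_reverse_mul_pow (algebraMap (ZMod 2) K) (D⁻¹ : K) p
    rw [invOf_eq_inv, inv_inv] at this
    rw [Polynomial.aeval_def, Polynomial.aeval_def, ← this, mul_assoc, ← mul_pow,
      inv_mul_cancel₀ D_ne_zero, one_pow, mul_one]
  have hr : algebraMap _ K p.reverse ≠ 0 := by simpa using hp
  rw [h, RatFunc.intDegree_mul hr (zpow_ne_zero _ D_ne_zero), intDegree_D_zpow,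
    RatFunc.intDegree_polynomial]
  omega

theorem IsLaurent.intDegree_add_nonneg {f : K} (hf : IsLaurent f) (hf0 : f ≠ 0) :
    0 ≤ f.intDegree + (EAQCC.bar f).intDegree := by
  obtain ⟨p, m, rfl⟩ := hf
  have hp : p ≠ 0 := by rintro rfl; simp at hf0
  have hp' : algebraMap _ K p ≠ 0 := by simpa using hp
  have hD : (D : K) ^ m = D ^ (m : ℤ) := (zpow_natCast _ _).symm
  rw [map_div₀, RatFunc.intDegree_div hp' (pow_ne_zero _ D_ne_zero),
    RatFunc.intDegree_div (by simpa using hp) (by simp [D_ne_zero]), hD, map_zpow₀, bar_D,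
    _root_.inv_zpow, RatFunc.intDegree_inv, intDegree_D_zpow, RatFunc.intDegree_polynomial]
  have := neg_natDegree_le_intDegree_aeval p hp
  omega

/-- The degree of `bar f` is minus the lowest exponent of `f`, so for Laurent polynomials the
truncation in `spread` is harmless. -/
theorem IsLaurent.spread_eq {f : K} (hf : IsLaurent f) (hf0 : f ≠ 0) :
    (spread f : ℤ) = f.intDegree + (EAQCC.bar f).intDegree + 1 := by
  have := hf.intDegree_add_nonneg hf0
  rw [spread, if_neg hf0]
  omega

theorem intDegree_add_le_of_le {f g : K} {b : ℤ} (hg : g ≠ 0) (hfg : f + g ≠ 0)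
    (hfb : f.intDegree ≤ b) (hgb : g.intDegree ≤ b) : (f + g).intDegree ≤ b :=
  (RatFunc.intDegree_add_le hg hfg).trans (max_le hfb hgb)

theorem bar_zpow (m : ℤ) : bar (D ^ m) = D ^ (-m) := by
  rw [map_zpow₀, bar_D, _root_.inv_zpow, _root_.zpow_neg]

theorem intDegree_zpow_mul (m : ℤ) {f : K} (hf : f ≠ 0) :
    (D ^ m * f).intDegree = m + f.intDegree := by
  rw [RatFunc.intDegree_mul (zpow_ne_zero _ D_ne_zero) hf, intDegree_D_zpow]

/-- A monomial multiple of a shorter Laurent polynomial cancels the highest term. -/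
theorem exists_spread_add_lt {f g : K} (hf : IsLaurent f) (hg : IsLaurent g) (hf0 : f ≠ 0)
    (hg0 : g ≠ 0) (h : spread g ≤ spread f) : ∃ m : ℤ, spread (f + D ^ m * g) < spread f := by
  have h1 := hf.spread_eq hf0
  have h2 := hg.spread_eq hg0
  have h0 := hf.intDegree_add_nonneg hf0
  refine ⟨f.intDegree - g.intDegree, ?_⟩
  set m := f.intDegree - g.intDegree with hm
  by_cases hs : f + D ^ m * g = 0
  · rw [hs, spread_zero]; omega
  have h3 := (hf.add ((IsLaurent.zpow m).mul hg)).spread_eq hs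
  have hmg : D ^ m * g ≠ 0 := mul_ne_zero (zpow_ne_zero _ D_ne_zero) hg0
  have h4 := intDegree_add_lt hf0 hmg (by rw [intDegree_zpow_mul _ hg0]; omega) hs
  -- Aligned at the top, the shorter `g` does not reach below the lowest term of `f`, so only the
  -- upper end moves.
  have h5 : (bar (f + D ^ m * g)).intDegree ≤ (bar f).intDegree := by
    rw [map_add]
    refine intDegree_add_le_of_le (by simpa using hmg)
      (by rw [← map_add]; exact bar_eq_zero.not.mpr hs) le_rfl ?_
    rw [map_mul, bar_zpow, intDegree_zpow_mul _ (by simpa using hg0)]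
    omega
  omega

/-- If `f / g` is invariant under `D ↦ D⁻¹`, then `1` or `D ^ m + D ^ (-m)` times `g` cancels both
the highest and the lowest term of `f`. -/
theorem exists_spread_add_symm_lt {f g : K} (hf : IsLaurent f) (hg : IsLaurent g) (hf0 : f ≠ 0)
    (hg0 : g ≠ 0) (h : spread g ≤ spread f) (hsymm : f * bar g = bar f * g) :
    spread (f + g) < spread f ∨
      ∃ m : ℤ, m ≠ 0 ∧ spread (f + (D ^ m + D ^ (-m)) * g) < spread f := by
  have h1 := hf.spread_eq hf0
  have h2 := hg.spread_eq hg0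
  have h0 := hf.intDegree_add_nonneg hf0
  have hbf : bar f ≠ 0 := by simpa using hf0
  have hbg : bar g ≠ 0 := by simpa using hg0
  -- Degrees in the symmetry relation show that the same offset `m` separates `f` from `g` at both
  -- ends; hence the spreads differ by `2 * m`, and `m` is nonnegative.
  have hd := congrArg RatFunc.intDegree hsymm
  rw [RatFunc.intDegree_mul hf0 hbg, RatFunc.intDegree_mul hbf hg0] at hd
  set m := f.intDegree - g.intDegree with hm
  obtain hm0 | hm0 : m = 0 ∨ 0 < m := by omega
  · left
    by_cases hs : f + g = 0
    · rw [hs, spread_zero]; omega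
    have hs' : bar f + bar g ≠ 0 := by rw [← map_add]; exact bar_eq_zero.not.mpr hs
    have h3 := (hf.add hg).spread_eq hs
    have h4 := intDegree_add_lt hf0 hg0 (by omega) hs
    have h5 := intDegree_add_lt hbf hbg (by omega) hs'
    rw [← map_add] at h5
    omega
  · right
    refine ⟨m, hm0.ne', ?_⟩
    by_cases hs : f + (D ^ m + D ^ (-m)) * g = 0
    · rw [hs, spread_zero]; omega
    have h3 := (hf.add (((IsLaurent.zpow m).add (IsLaurent.zpow (-m))).mul hg)).spread_eq hs
    -- The factor `D ^ m + D ^ (-m)` is fixed by `bar`, so one estimate, used for `f, g` and for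
    -- `bar f, bar g`, handles both ends.
    have key : ∀ {f g : K}, f ≠ 0 → g ≠ 0 → f.intDegree = m + g.intDegree →
        f + (D ^ m + D ^ (-m)) * g ≠ 0 →
        (f + (D ^ m + D ^ (-m)) * g).intDegree < f.intDegree := by
      intro f g hf0 hg0 hfg hs
      have hmg : ∀ m : ℤ, D ^ m * g ≠ 0 := fun m => mul_ne_zero (zpow_ne_zero _ D_ne_zero) hg0
      have e : f + (D ^ m + D ^ (-m)) * g = f + D ^ m * g + D ^ (-m) * g := by ring
      have b1 : (D ^ (-m) * g).intDegree < f.intDegree := by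
        rw [intDegree_zpow_mul _ hg0]; omega
      rw [e] at hs ⊢
      by_cases hs1 : f + D ^ m * g = 0
      · rwa [hs1, zero_add]
      have b2 := intDegree_add_lt hf0 (hmg m) (by rw [intDegree_zpow_mul _ hg0]; omega) hs1
      exact (RatFunc.intDegree_add_le (hmg _) hs).trans_lt (max_lt b2 b1)
    have hb : bar (f + (D ^ m + D ^ (-m)) * g) = bar f + (D ^ m + D ^ (-m)) * bar g := by
      rw [map_add, map_mul, map_add, bar_zpow, bar_zpow, neg_neg, add_comm (D ^ (-m))]
    have h4 := key hf0 hg0 (by omega) hs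
    have h5 := key hbf hbg (by omega) (by rw [← hb]; exact bar_eq_zero.not.mpr hs)
    rw [← hb] at h5
    omega

/-! ### The shifted symplectic form and the action of the gates -/

section Form

variable {q : Type} [Fintype q]

/-- The shifted symplectic product of two Pauli sequences. -/
def sform (v w : q ⊕ q → K) : K := ∑ s, v s * bar (w s.swap)

theorem shiftedSymplectic_apply {r : Type} (H : Matrix r (q ⊕ q) K) (i j : r) :
    shiftedSymplectic H i j = sform (H i) (H j) := by
  simp [shiftedSymplectic, sform, Matrix.mul_apply, toCols₁, toCols₂]

theorem sform_add_left (u v w : q ⊕ q → K) : sform (u + v) w = sform u w + sform v w := by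
  simp [sform, add_mul, Finset.sum_add_distrib]

theorem sform_add_right (u v w : q ⊕ q → K) : sform u (v + w) = sform u v + sform u w := by
  simp [sform, mul_add, Finset.sum_add_distrib]

theorem sform_smul_left (x : K) (v w : q ⊕ q → K) : sform (x • v) w = x * sform v w := by
  simp only [sform, Finset.mul_sum, mul_assoc, Pi.smul_apply, smul_eq_mul]

theorem sform_smul_right (x : K) (v w : q ⊕ q → K) : sform v (x • w) = bar x * sform v w := by
  simp only [sform, Finset.mul_sum, mul_left_comm, Pi.smul_apply, smul_eq_mul, map_mul]

theorem bar_sform (v w : q ⊕ q → K) : bar (sform v w) = sform w v := by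
  simp only [sform, map_sum, map_mul, bar_bar]
  refine Fintype.sum_equiv (Equiv.sumComm q q) _ _ fun s => ?_
  simp [mul_comm]

/-- The form `sform · w` as a linear functional. -/
def sformLinear (w : q ⊕ q → K) : (q ⊕ q → K) →ₗ[K] K where
  toFun v := sform v w
  map_add' u v := sform_add_left u v w
  map_smul' x v := sform_smul_left x v w

@[simp]
theorem sformLinear_apply (v w : q ⊕ q → K) : sformLinear w v = sform v w := rfl

variable [DecidableEq q]

@[simp]
theorem sform_single_left (s : q ⊕ q) (x : K) (w : q ⊕ q → K) :
    sform (Pi.single s x) w = x * bar (w s.swap) := by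
  rw [sform, Finset.sum_eq_single s] <;> simp +contextual

@[simp]
theorem sform_single_right (s : q ⊕ q) (x : K) (v : q ⊕ q → K) :
    sform v (Pi.single s x) = v s.swap * bar x := by
  rw [← bar_sform, sform_single_left]
  simp [mul_comm]

theorem vecMul_single_eq (v : q ⊕ q → K) (s t : q ⊕ q) (x : K) :
    v ᵥ* single s t x = Pi.single t (v s * x) := by
  ext k
  by_cases h : k = t
  · subst h
    simp [vecMul, dotProduct, single_apply, -Fintype.sum_sum_type]
  · simp [vecMul, dotProduct, h, Ne.symm h]

@[simp]
theorem vecMul_hadamard (v : q ⊕ q → K) (i : q) :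
    v ᵥ* (FiniteDepthGate.hadamard i).toMatrix = v ∘ Equiv.swap (.inl i) (.inr i) := by
  ext k
  simp [FiniteDepthGate.toMatrix, vecMul, dotProduct, one_apply]

@[simp]
theorem vecMul_phase (v : q ⊕ q → K) (i : q) :
    v ᵥ* (FiniteDepthGate.phase i).toMatrix = v + Pi.single (.inl i) (v (.inr i)) := by
  simp [FiniteDepthGate.toMatrix, vecMul_add, vecMul_single_eq]

@[simp]
theorem vecMul_cnot (v : q ⊕ q → K) (i j : q) (hij : i ≠ j) (m : ℤ) :
    v ᵥ* (FiniteDepthGate.cnot i j hij m).toMatrix =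
      v + Pi.single (.inr j) (v (.inr i) * D ^ m) + Pi.single (.inl i) (v (.inl j) * D ^ (-m)) := by
  simp only [FiniteDepthGate.toMatrix, vecMul_add, vecMul_single_eq, vecMul_one]

@[simp]
theorem vecMul_cphase (v : q ⊕ q → K) (i j : q) (hij : i ≠ j) (m : ℤ) :
    v ᵥ* (FiniteDepthGate.cphase i j hij m).toMatrix =
      v + Pi.single (.inl j) (v (.inr i) * D ^ m) + Pi.single (.inl i) (v (.inr j) * D ^ (-m)) := by
  simp only [FiniteDepthGate.toMatrix, vecMul_add, vecMul_single_eq, vecMul_one]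

@[simp]
theorem vecMul_selfCphase (v : q ⊕ q → K) (i : q) (m : ℤ) (hm : m ≠ 0) :
    v ᵥ* (FiniteDepthGate.selfCphase i m hm).toMatrix =
      v + Pi.single (.inl i) (v (.inr i) * (D ^ m + D ^ (-m))) := by
  simp only [FiniteDepthGate.toMatrix, vecMul_add, vecMul_single_eq, vecMul_one]

theorem vecMul_infiniteDepth (v : q ⊕ q → K) (i : q) (f : K) (hf : IsLaurent f) (hf0 : f ≠ 0) :
    v ᵥ* (Gate.infiniteDepth i f hf hf0).toMatrix =
      fun s => v s *
        Sum.elim (Function.update (1 : q → K) i (bar f)) (Function.update (1 : q → K) i f⁻¹) s := by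
  ext s
  simp [Gate.toMatrix, vecMul_diagonal]

/-- The extra terms in the form occur in equal pairs and cancel in characteristic 2; Hadamard merely
permutes the summands. -/
theorem sform_vecMul_gate (g : FiniteDepthGate q) (v w : q ⊕ q → K) :
    sform (v ᵥ* g.toMatrix) (w ᵥ* g.toMatrix) = sform v w := by
  have h2 := add_self
  cases g with
  | hadamard i =>
    rw [vecMul_hadamard, vecMul_hadamard, sform, sform]
    refine Fintype.sum_equiv (Equiv.swap (.inl i) (.inr i)) _ _ fun s => ?_
    have : Equiv.swap (Sum.inl i) (Sum.inr i) s.swap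
        = (Equiv.swap (Sum.inl i) (Sum.inr i) s).swap := by
      rcases s with j | j <;> by_cases h : j = i <;> simp [h, Equiv.swap_apply_def]
    simp [this]
  | phase i =>
    simp only [vecMul_phase, sform_add_left, sform_add_right, sform_single_left,
      sform_single_right]
    simp
    linear_combination h2 (v (.inr i) * bar (w (.inr i)))
  | cnot i j hij m =>
    simp only [vecMul_cnot, sform_add_left, sform_add_right, sform_single_left,
      sform_single_right]
    simp [hij, hij.symm]
    linear_combination h2 (v (.inr i) * D ^ m * bar (w (.inl j))) +
      h2 (v (.inl j) * (D ^ m)⁻¹ * bar (w (.inr i)))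
  | cphase i j hij m =>
    simp only [vecMul_cphase, sform_add_left, sform_add_right, sform_single_left,
      sform_single_right]
    simp
    linear_combination h2 (v (.inr i) * D ^ m * bar (w (.inr j))) +
      h2 (v (.inr j) * (D ^ m)⁻¹ * bar (w (.inr i)))
  | selfCphase i m hm =>
    simp only [vecMul_selfCphase, sform_add_left, sform_add_right, sform_single_left,
      sform_single_right]
    simp
    linear_combination h2 (v (.inr i) * (D ^ m + (D ^ m)⁻¹) * bar (w (.inr i)))

/-- The entries that an additive gate reads are never those it changes, so a second application adds
the same terms again. Hence reversing a finite-depth circuit inverts it. -/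
theorem gate_mul_self (g : FiniteDepthGate q) : g.toMatrix * g.toMatrix = 1 := by
  have h2 := add_self
  refine ext_of_single_vecMul fun s => ?_
  rw [← vecMul_vecMul, vecMul_one]
  generalize (Pi.single s 1 : q ⊕ q → K) = v
  cases g with
  | hadamard i => ext s; simp
  | phase i =>
    ext s
    simp [Pi.single_apply]
    linear_combination h2 (if s = Sum.inl i then v (Sum.inr i) else 0)
  | cnot i j hij m =>
    ext s
    simp [Pi.single_apply, hij, hij.symm]
    linear_combination h2 (if s = Sum.inr j then v (Sum.inr i) * D ^ m else 0) +
      h2 (if s = Sum.inl i then v (Sum.inl j) * (D ^ m)⁻¹ else 0)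
  | cphase i j hij m =>
    ext s
    simp [Pi.single_apply]
    linear_combination h2 (if s = Sum.inl j then v (Sum.inr i) * D ^ m else 0) +
      h2 (if s = Sum.inl i then v (Sum.inr j) * (D ^ m)⁻¹ else 0)
  | selfCphase i m hm =>
    ext s
    simp [Pi.single_apply]
    linear_combination h2 (if s = Sum.inl i then v (Sum.inr i) * (D ^ m + (D ^ m)⁻¹) else 0)

omit [Fintype q] in
theorem isLaurent_gate (g : FiniteDepthGate q) (s t : q ⊕ q) : IsLaurent (g.toMatrix s t) := by
  have h1 : ∀ s t, IsLaurent ((1 : Matrix (q ⊕ q) (q ⊕ q) K) s t) := fun s t => by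
    rw [one_apply]; split_ifs <;> [exact .one; exact .zero]
  have hs : ∀ (a b : q ⊕ q) {x : K}, IsLaurent x → IsLaurent (single a b x s t) :=
    fun a b x hx => by rw [single_apply]; split_ifs <;> [exact hx; exact .zero]
  cases g with
  | hadamard i => exact h1 _ _
  | phase i => exact (h1 _ _).add (hs _ _ .one)
  | cnot i j hij m => exact ((h1 _ _).add (hs _ _ (.zpow _))).add (hs _ _ (.zpow _))
  | cphase i j hij m => exact ((h1 _ _).add (hs _ _ (.zpow _))).add (hs _ _ (.zpow _))
  | selfCphase i m hm => exact (h1 _ _).add (hs _ _ ((IsLaurent.zpow _).add (.zpow _)))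

end Form

/-! ### Circuits -/

section Circuits

variable {q q' : Type} [Fintype q] [DecidableEq q] [Fintype q'] [DecidableEq q']

@[simp]
theorem circuitMatrix_nil : circuitMatrix ([] : List (Gate q)) = 1 := rfl

theorem circuitMatrix_cons (g : Gate q) (gs : List (Gate q)) :
    circuitMatrix (g :: gs) = g.toMatrix * circuitMatrix gs := by
  simp [circuitMatrix]

theorem circuitMatrix_append (gs hs : List (Gate q)) :
    circuitMatrix (gs ++ hs) = circuitMatrix gs * circuitMatrix hs := by
  simp [circuitMatrix]

/-- The action of a finite-depth circuit. -/
def finiteDepthMatrix (gs : List (FiniteDepthGate q)) : Matrix (q ⊕ q) (q ⊕ q) K :=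
  circuitMatrix (gs.map Gate.finiteDepth)

@[simp]
theorem finiteDepthMatrix_nil : finiteDepthMatrix ([] : List (FiniteDepthGate q)) = 1 := rfl

theorem finiteDepthMatrix_cons (g : FiniteDepthGate q) (gs : List (FiniteDepthGate q)) :
    finiteDepthMatrix (g :: gs) = g.toMatrix * finiteDepthMatrix gs := by
  simp [finiteDepthMatrix, circuitMatrix_cons, Gate.toMatrix]

theorem finiteDepthMatrix_append (gs hs : List (FiniteDepthGate q)) :
    finiteDepthMatrix (gs ++ hs) = finiteDepthMatrix gs * finiteDepthMatrix hs := by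
  simp [finiteDepthMatrix, circuitMatrix_append]

@[simp]
theorem finiteDepthMatrix_singleton (g : FiniteDepthGate q) :
    finiteDepthMatrix [g] = g.toMatrix := by
  simp [finiteDepthMatrix_cons]

theorem sform_vecMul_finiteDepthMatrix (gs : List (FiniteDepthGate q)) (v w : q ⊕ q → K) :
    sform (v ᵥ* finiteDepthMatrix gs) (w ᵥ* finiteDepthMatrix gs) = sform v w := by
  induction gs generalizing v w with
  | nil => simp
  | cons g gs ih =>
    rw [finiteDepthMatrix_cons, ← vecMul_vecMul, ← vecMul_vecMul, ih, sform_vecMul_gate]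

theorem finiteDepthMatrix_mul_reverse (gs : List (FiniteDepthGate q)) :
    finiteDepthMatrix gs * finiteDepthMatrix gs.reverse = 1 := by
  induction gs with
  | nil => simp
  | cons g gs ih =>
    rw [List.reverse_cons, finiteDepthMatrix_append, finiteDepthMatrix_cons,
      finiteDepthMatrix_singleton, Matrix.mul_assoc, ← Matrix.mul_assoc _ _ g.toMatrix, ih,
      Matrix.one_mul, gate_mul_self]

theorem finiteDepthMatrix_reverse_mul (gs : List (FiniteDepthGate q)) :
    finiteDepthMatrix gs.reverse * finiteDepthMatrix gs = 1 := by
  simpa using finiteDepthMatrix_mul_reverse gs.reverse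

theorem isLaurent_finiteDepthMatrix (gs : List (FiniteDepthGate q)) (s t : q ⊕ q) :
    IsLaurent (finiteDepthMatrix gs s t) := by
  induction gs generalizing s t with
  | nil => rw [finiteDepthMatrix_nil, one_apply]; split_ifs <;> [exact .one; exact .zero]
  | cons g gs ih =>
    rw [finiteDepthMatrix_cons, mul_apply]
    exact .sum fun i _ => (isLaurent_gate _ _ _).mul (ih _ _)

theorem vecMul_map_gate (e : q ↪ q') (g : Gate q) (v : q' ⊕ q' → K) :
    (v ᵥ* (g.map e).toMatrix) ∘ Sum.map e e = (v ∘ Sum.map e e) ᵥ* g.toMatrix ∧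
      ∀ s ∉ Set.range (Sum.map e e), (v ᵥ* (g.map e).toMatrix) s = v s := by
  have hl : ∀ (i : q) (x : K),
      (Pi.single (Sum.inl (e i)) x : q' ⊕ q' → K) ∘ Sum.map e e = Pi.single (Sum.inl i) x := by
    intro i x; ext (j | j) <;> simp [Pi.single_apply]
  have hr : ∀ (i : q) (x : K),
      (Pi.single (Sum.inr (e i)) x : q' ⊕ q' → K) ∘ Sum.map e e = Pi.single (Sum.inr i) x := by
    intro i x; ext (j | j) <;> simp [Pi.single_apply]
  have hadd : ∀ u w : q' ⊕ q' → K,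
      (u + w) ∘ Sum.map e e = u ∘ Sum.map e e + w ∘ Sum.map e e := fun _ _ => rfl
  have hnl : ∀ s ∉ Set.range (Sum.map e e), ∀ i, s ≠ Sum.inl (e i) := by
    rintro s hs i rfl; exact hs ⟨.inl i, rfl⟩
  have hnr : ∀ s ∉ Set.range (Sum.map e e), ∀ i, s ≠ Sum.inr (e i) := by
    rintro s hs i rfl; exact hs ⟨.inr i, rfl⟩
  cases g with
  | finiteDepth g =>
    simp only [Gate.map, Gate.toMatrix]
    cases g with
    | hadamard i =>
      simp only [FiniteDepthGate.map, vecMul_hadamard]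
      refine ⟨?_, fun s hs => ?_⟩
      · ext (j | j) <;> by_cases h : j = i <;> simp [h, Equiv.swap_apply_def]
      · simp [Equiv.swap_apply_of_ne_of_ne (hnl s hs i) (hnr s hs i)]
    | phase i =>
      simp only [FiniteDepthGate.map, vecMul_phase, hadd, hl]
      refine ⟨rfl, fun s hs => by simp [hnl s hs]⟩
    | cnot i j hij m =>
      simp only [FiniteDepthGate.map, vecMul_cnot, hadd, hl, hr]
      refine ⟨rfl, fun s hs => by simp [hnl s hs, hnr s hs]⟩
    | cphase i j hij m =>
      simp only [FiniteDepthGate.map, vecMul_cphase, hadd, hl]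
      refine ⟨rfl, fun s hs => by simp [hnl s hs]⟩
    | selfCphase i m hm =>
      simp only [FiniteDepthGate.map, vecMul_selfCphase, hadd, hl]
      refine ⟨rfl, fun s hs => by simp [hnl s hs]⟩
  | infiniteDepth i f hf hf0 =>
    simp only [Gate.map, vecMul_infiniteDepth]
    refine ⟨?_, ?_⟩
    · ext (j | j) <;> simp [Function.update_apply]
    · rintro (j | j) hs
      · have := hnl _ hs i
        simp_all
      · have := hnr _ hs i
        simp_all

theorem vecMul_map_circuit (e : q ↪ q') (gs : List (Gate q)) (v : q' ⊕ q' → K) :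
    (v ᵥ* circuitMatrix (gs.map (Gate.map e))) ∘ Sum.map e e
        = (v ∘ Sum.map e e) ᵥ* circuitMatrix gs ∧
      ∀ s ∉ Set.range (Sum.map e e), (v ᵥ* circuitMatrix (gs.map (Gate.map e))) s = v s := by
  induction gs generalizing v with
  | nil => simp
  | cons g gs ih =>
    rw [List.map_cons, circuitMatrix_cons, circuitMatrix_cons, ← vecMul_vecMul, ← vecMul_vecMul,
      (ih _).1, (vecMul_map_gate e g v).1]
    exact ⟨rfl, fun s hs => by rw [(ih _).2 s hs, (vecMul_map_gate e g v).2 s hs]⟩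

theorem vecMul_map_finiteDepth (e : q ↪ q') (gs : List (FiniteDepthGate q)) (v : q' ⊕ q' → K) :
    (v ᵥ* finiteDepthMatrix (gs.map (FiniteDepthGate.map e))) ∘ Sum.map e e
        = (v ∘ Sum.map e e) ᵥ* finiteDepthMatrix gs ∧
      ∀ s ∉ Set.range (Sum.map e e),
        (v ᵥ* finiteDepthMatrix (gs.map (FiniteDepthGate.map e))) s = v s := by
  have := vecMul_map_circuit e (gs.map Gate.finiteDepth) v
  rw [List.map_map] at this
  rw [finiteDepthMatrix, finiteDepthMatrix, List.map_map]
  exact this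

end Circuits

/-! ### Reduction of an isotropic vector -/

section Reduction

variable {q : Type} [Fintype q] [DecidableEq q]

/-- The qubit of a column of a check matrix. -/
abbrev qubit (s : q ⊕ q) : q := Sum.elim id id s

/-- Euclid's algorithm, organized as a minimality argument over the orbit of `v`: at a minimum no
gate can shorten an entry, which leaves only one nonzero entry. -/
theorem exists_circuit_of_isLaurent (v : q ⊕ q → K) (hL : ∀ s, IsLaurent (v s)) (hv : v ≠ 0)
    (hiso : sform v v = 0) :
    ∃ (gs : List (FiniteDepthGate q)) (t : q) (x : K), x ≠ 0 ∧
      v ᵥ* finiteDepthMatrix gs = x • pauliZ t := by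
  let O : Set (q ⊕ q → K) := {w | ∃ gs, w = v ᵥ* finiteDepthMatrix gs}
  have hO : ∀ w ∈ O, ∀ g : FiniteDepthGate q, w ᵥ* g.toMatrix ∈ O := by
    rintro _ ⟨gs, rfl⟩ g
    exact ⟨gs ++ [g], by
      rw [finiteDepthMatrix_append, finiteDepthMatrix_singleton, vecMul_vecMul]⟩
  have hOL : ∀ w ∈ O, ∀ s, IsLaurent (w s) := by
    rintro _ ⟨gs, rfl⟩ s
    exact .sum fun i _ => (hL _).mul (isLaurent_finiteDepthMatrix _ _ _)
  have hOi : ∀ w ∈ O, sform w w = 0 := by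
    rintro _ ⟨gs, rfl⟩
    rw [sform_vecMul_finiteDepthMatrix, hiso]
  have hvO : v ∈ O := ⟨[], by simp⟩
  let S : Set ((q ⊕ q → K) × q) := {p | p.1 ∈ O ∧ p.1 (.inr p.2) ≠ 0}
  have hS : S.Nonempty := by
    obtain ⟨s, hs⟩ := Function.ne_iff.mp hv
    rcases s with i | i
    · exact ⟨(v ᵥ* (FiniteDepthGate.hadamard i).toMatrix, i), hO _ hvO _, by simpa using hs⟩
    · exact ⟨(v, i), hvO, hs⟩
  -- The order of priorities matters: clearing another qubit by a gate controlled by `i` preserves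
  -- `X_i` but may lengthen `Z_i`, so `Z_i` comes last.
  let μ : (q ⊕ q → K) × q → ℕ ×ₗ ℕ ×ₗ ℕ := fun p =>
    toLex (spread (p.1 (.inr p.2)),
      toLex (∑ s, if qubit s = p.2 then 0 else spread (p.1 s), spread (p.1 (.inl p.2))))
  obtain ⟨⟨w, i⟩, ⟨hwO, hwi⟩, hmin⟩ := (InvImage.wf μ wellFounded_lt).has_min S hS
  have hmin1 : ∀ w' ∈ O, ∀ j, w' (.inr j) ≠ 0 → spread (w (.inr i)) ≤ spread (w' (.inr j)) := by
    intro w' hw' j hj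
    by_contra! hlt
    exact hmin (w', j) ⟨hw', hj⟩ (Prod.Lex.toLex_lt_toLex.mpr (.inl hlt))
  -- A Hadamard turns any Z entry into an X entry, so the pivot is shortest among all nonzero
  -- entries.
  have hmin1' : ∀ s, w s ≠ 0 → spread (w (.inr i)) ≤ spread (w s) := by
    rintro (j | j) hj
    · have := hmin1 _ (hO _ hwO (.hadamard j)) j (by simpa using hj)
      simpa using this
    · exact hmin1 w hwO j hj
  have hmin2 : ∀ w' ∈ O, w' (.inr i) = w (.inr i) → ∀ s₀, qubit s₀ ≠ i →
      (∀ s, qubit s ≠ i → s ≠ s₀ → w' s = w s) → ¬ spread (w' s₀) < spread (w s₀) := by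
    intro w' hw' hx s₀ hs₀ hs hlt
    refine hmin (w', i) ⟨hw', hx.trans_ne hwi⟩
      (Prod.Lex.toLex_lt_toLex.mpr (.inr ⟨by simp [hx], Prod.Lex.toLex_lt_toLex.mpr (.inl ?_)⟩))
    refine Finset.sum_lt_sum (fun s _ => ?_) ⟨s₀, Finset.mem_univ _, by simpa [hs₀] using hlt⟩
    by_cases h1 : qubit s = i
    · simp [h1]
    · by_cases h2 : s = s₀
      · subst h2; simpa [h1] using hlt.le
      · simp only [hs s h1 h2]; rfl
  have hsupp : ∀ s, qubit s ≠ i → w s = 0 := by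
    intro s hs
    by_contra hs0
    obtain ⟨m, hm⟩ := exists_spread_add_lt (hOL _ hwO s) (hOL _ hwO (.inr i)) hs0 hwi
      (hmin1' s hs0)
    rw [mul_comm] at hm
    rcases s with j | j
    · refine hmin2 _ (hO _ hwO (.cphase i j (Ne.symm hs) m)) ?_ (.inl j) hs ?_ ?_
      · simp
      · rintro (k | k) h1 h2 <;> simp_all
      · have hs' : j ≠ i := hs
        simpa [hs'] using hm
    · refine hmin2 _ (hO _ hwO (.cnot i j (Ne.symm hs) m)) ?_ (.inr j) hs ?_ ?_
      · have hs' : i ≠ j := Ne.symm hs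
        simp [hs']
      · rintro (k | k) h1 h2 <;> simp_all
      · simpa using hm
  have hmin3 : ∀ w' ∈ O, (∀ s, s ≠ .inl i → w' s = w s) →
      ¬ spread (w' (.inl i)) < spread (w (.inl i)) := by
    intro w' hw' hs hlt
    have hx := hs (.inr i) (by simp)
    refine hmin (w', i) ⟨hw', hx.trans_ne hwi⟩
      (Prod.Lex.toLex_lt_toLex.mpr (.inr ⟨by simp [hx], Prod.Lex.toLex_lt_toLex.mpr
        (.inr ⟨Finset.sum_congr rfl fun s _ => ?_, hlt⟩)⟩))
    by_cases h1 : qubit s = i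
    · simp [h1]
    · simp only [h1, if_false]
      rw [hs s (by rintro rfl; exact h1 rfl)]
  have hw : w = Pi.single (.inl i) (w (.inl i)) + Pi.single (.inr i) (w (.inr i)) := by
    ext (j | j) <;> by_cases h : j = i
    · subst h; simp
    · simpa [h] using hsupp (.inl j) h
    · subst h; simp
    · simpa [h] using hsupp (.inr j) h
  -- With only qubit `i` left, isotropy says that `Z_i / X_i` is fixed by `bar`. This is exactly
  -- what lets the phase and self-controlled-phase gates, whose coefficients are symmetric, shorten
  -- `Z_i`.
  have hz : w (.inl i) = 0 := by
    by_contra hz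
    have h0 := hOi w hwO
    nth_rw 1 [hw] at h0
    rw [sform_add_left, sform_single_left, sform_single_left] at h0
    have h0' : w (.inl i) * bar (w (.inr i)) = bar (w (.inl i)) * w (.inr i) := by
      rw [mul_comm (bar _)]
      exact CharTwo.add_eq_zero.mp h0
    obtain h | ⟨m, hm, h⟩ := exists_spread_add_symm_lt (hOL _ hwO _) (hOL _ hwO _) hz hwi
      (hmin1' _ hz) h0'
    · refine hmin3 _ (hO _ hwO (.phase i)) (fun s hs => ?_) ?_
      · simp [hs]
      · simpa using h
    · refine hmin3 _ (hO _ hwO (.selfCphase i m hm)) (fun s hs => ?_) ?_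
      · simp [hs]
      · rw [mul_comm] at h
        simpa using h
  obtain ⟨gs, hgs⟩ := hwO
  refine ⟨gs ++ [.hadamard i], i, w (.inr i), hwi, ?_⟩
  rw [finiteDepthMatrix_append, ← vecMul_vecMul, ← hgs, finiteDepthMatrix_singleton,
    vecMul_hadamard, hw, hz]
  ext (j | j) <;> by_cases h : j = i <;>
    simp [h, pauliZ, Equiv.swap_apply_def]

/-- A nonzero self-orthogonal vector is taken to a multiple of a Pauli operator `Z` by a
finite-depth circuit. -/
theorem exists_circuit_of_isotropic (v : q ⊕ q → K) (hv : v ≠ 0) (hiso : sform v v = 0) :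
    ∃ (gs : List (FiniteDepthGate q)) (t : q) (x : K), x ≠ 0 ∧
      v ᵥ* finiteDepthMatrix gs = x • pauliZ t := by
  obtain ⟨s, hs0, -, hs⟩ := exists_common_denominator v
  obtain ⟨gs, t, x, hx, h⟩ := exists_circuit_of_isLaurent (s • v) hs (smul_ne_zero hs0 hv)
    (by rw [sform_smul_left, sform_smul_right, hiso]; simp)
  refine ⟨gs, t, s⁻¹ * x, mul_ne_zero (inv_ne_zero hs0) hx, ?_⟩
  rw [mul_smul, ← h, smul_vecMul, inv_smul_smul₀ hs0]

end Reduction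

/-! ### Straightening a flag of isotropic subspaces -/

section Prefix

variable {q : Type} [Fintype q] [DecidableEq q]

/-- A self-orthogonal vector that commutes with the operators `Z` on the qubits `B` is reduced by
a circuit on the other qubits. -/
theorem exists_circuit_off (B : Finset q) (w : q ⊕ q → K) (hB : ∀ b ∈ B, w (.inr b) = 0)
    (hw : ∃ s, qubit s ∉ B ∧ w s ≠ 0) (hiso : sform w w = 0) :
    ∃ (gs : List (FiniteDepthGate q)) (t : q) (x : K), t ∉ B ∧ x ≠ 0 ∧
      (∀ b ∈ B, pauliZ b ᵥ* finiteDepthMatrix gs = pauliZ b) ∧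
      w ᵥ* finiteDepthMatrix gs = x • pauliZ t + ∑ b ∈ B, w (.inl b) • pauliZ b := by
  let e : {b // b ∉ B} ↪ q := Function.Embedding.subtype _
  have hrange : ∀ s, s ∉ Set.range (Sum.map e e) → qubit s ∈ B := by
    intro s hs
    by_contra hsB
    rcases s with j | j
    · exact hs ⟨.inl ⟨j, hsB⟩, rfl⟩
    · exact hs ⟨.inr ⟨j, hsB⟩, rfl⟩
  have hinj : Function.Injective (Sum.map e e) := e.injective.sumMap e.injective
  obtain ⟨gs, t, x, hx, h⟩ := exists_circuit_of_isotropic (w ∘ Sum.map e e) (by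
      obtain ⟨s, hsB, hs⟩ := hw
      rcases s with j | j
      · exact Function.ne_iff.mpr ⟨.inl ⟨j, hsB⟩, hs⟩
      · exact Function.ne_iff.mpr ⟨.inr ⟨j, hsB⟩, hs⟩) (by
      -- Each term of the form on `B` contains an X entry, which vanishes there, so the restriction
      -- to the other qubits is still isotropic.
      rw [← hiso]
      refine Fintype.sum_of_injective (Sum.map e e) hinj _ _ (fun s hs => ?_) (fun s => ?_)
      · rcases s with j | j
        · simp [hB j (hrange _ hs)]
        · simp [hB j (hrange _ hs)]
      · rcases s with j | j <;> rfl)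
  refine ⟨gs.map (FiniteDepthGate.map e), t, x, t.2, hx, fun b hb => ?_, ?_⟩
  · obtain ⟨h1, h2⟩ := vecMul_map_finiteDepth e gs (pauliZ b)
    have h0 : (pauliZ b ∘ Sum.map e e : _ → K) = 0 := by
      ext (j | j)
      · have : (j : q) ≠ b := fun h => j.2 (h ▸ hb)
        simp [pauliZ, e, this]
      · simp [pauliZ]
    rw [h0, zero_vecMul] at h1
    ext s
    by_cases hs : s ∈ Set.range (Sum.map e e)
    · obtain ⟨s, rfl⟩ := hs
      exact (congrFun h1 s).trans (congrFun h0 s).symm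
    · exact h2 s hs
  · obtain ⟨h1, h2⟩ := vecMul_map_finiteDepth e gs w
    rw [h] at h1
    ext s
    by_cases hs : s ∈ Set.range (Sum.map e e)
    · obtain ⟨s, rfl⟩ := hs
      refine (congrFun h1 s).trans ?_
      rcases s with j | j
      · simp [pauliZ, e, Finset.sum_apply, Pi.single_apply, Subtype.ext_iff, j.2]
      · simp [pauliZ, e, Finset.sum_apply]
    · rw [h2 s hs]
      have hsB := hrange s hs
      rcases s with j | j
      · have hjt : j ≠ t := fun h => t.2 (h ▸ hsB)
        have hsB : j ∈ B := hsB
        simp [pauliZ, Finset.sum_apply, hjt, Pi.single_apply, hsB]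
      · simp [pauliZ, Finset.sum_apply, hB j hsB]

omit [DecidableEq q] in
theorem span_vecMul_image {ι : Type*} (M : Matrix (q ⊕ q) (q ⊕ q) K) (u : ι → q ⊕ q → K)
    (s : Set ι) :
    Submodule.span K ((fun i => u i ᵥ* M) '' s) =
      (Submodule.span K (u '' s)).map M.vecMulLinear := by
  rw [Submodule.map_span, Set.image_image]
  rfl

omit [DecidableEq q] in
theorem sform_eq_zero_of_mem_span {S : Set (q ⊕ q → K)} {w : q ⊕ q → K}
    (h : ∀ v ∈ S, sform v w = 0) {v : q ⊕ q → K} (hv : v ∈ Submodule.span K S) :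
    sform v w = 0 := by
  have : Submodule.span K S ≤ LinearMap.ker (sformLinear w) :=
    Submodule.span_le.mpr fun v hv => h v hv
  exact this hv

@[simp]
theorem sform_pauliZ_left (b : q) (w : q ⊕ q → K) : sform (pauliZ b) w = bar (w (.inr b)) := by
  simp [pauliZ]

/-- Gram–Schmidt for isotropic families: every initial segment of the family is taken to the
operators `Z` on as many qubits. -/
theorem exists_circuit_prefix (u : ℕ → q ⊕ q → K) (r : ℕ)
    (hind : ∀ k < r, u k ∉ Submodule.span K (u '' Set.Iio k))
    (hiso : ∀ i < r, ∀ j < r, sform (u i) (u j) = 0) :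
    ∃ (gs : List (FiniteDepthGate q)) (L : List q), L.Nodup ∧ L.length = r ∧
      ∀ k ≤ r, Submodule.span K ((fun i => u i ᵥ* finiteDepthMatrix gs) '' Set.Iio k) =
        Submodule.span K (pauliZ '' {b | b ∈ L.take k}) := by
  induction r with
  | zero => exact ⟨[], [], by simp, rfl, fun k hk => by
      obtain rfl : k = 0 := by omega
      simp⟩
  | succ r ih =>
    obtain ⟨gs, L, hL, hlen, hspan⟩ := ih (fun k hk => hind k (by omega))
      (fun i hi j hj => hiso i (by omega) j (by omega))
    have hspan_r := hspan r le_rfl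
    rw [List.take_of_length_le hlen.le] at hspan_r
    set w := u r ᵥ* finiteDepthMatrix gs with hw
    -- The operators `Z` already obtained are combinations of transformed earlier vectors, to which
    -- `w` is orthogonal.
    have hB : ∀ b ∈ L.toFinset, w (.inr b) = 0 := by
      intro b hb
      have hmem : pauliZ b ∈ Submodule.span K (pauliZ '' {b | b ∈ L}) :=
        Submodule.subset_span ⟨b, by simpa using hb, rfl⟩
      rw [← hspan_r] at hmem
      have := sform_eq_zero_of_mem_span (w := w) (by
        rintro _ ⟨i, hi, rfl⟩
        have hi : i < r := hi
        rw [hw, sform_vecMul_finiteDepthMatrix]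
        exact hiso i (by omega) r (by omega)) hmem
      simpa using this
    -- Otherwise `w` would be a combination of the `Z` on `L`, hence of the earlier vectors,
    -- contrary to independence.
    have hex : ∃ s, qubit s ∉ L.toFinset ∧ w s ≠ 0 := by
      by_contra! hcon
      have hmem : w ∈ Submodule.span K (pauliZ '' {b | b ∈ L}) := by
        have : w = ∑ b ∈ L.toFinset, w (.inl b) • pauliZ b := by
          ext (j | j)
          · by_cases hj : j ∈ L
            · simp [pauliZ, Finset.sum_apply, Pi.single_apply, hj]
            · simpa [pauliZ, Finset.sum_apply, Pi.single_apply, hj] using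
                hcon (.inl j) (by simpa using hj)
          · by_cases hj : j ∈ L
            · simpa [pauliZ, Finset.sum_apply] using hB j (by simpa using hj)
            · simpa [pauliZ, Finset.sum_apply] using hcon (.inr j) (by simpa using hj)
        rw [this]
        exact Submodule.sum_mem _ fun b hb => Submodule.smul_mem _ _
          (Submodule.subset_span ⟨b, by simpa using hb, rfl⟩)
      rw [← hspan_r, span_vecMul_image] at hmem
      obtain ⟨y, hy, hyw⟩ := hmem
      have : y = u r := by
        have := congrArg (· ᵥ* finiteDepthMatrix gs.reverse) hyw
        simpa [hw, finiteDepthMatrix_mul_reverse] using this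
      exact hind r (by omega) (this ▸ hy)
    obtain ⟨gs', t, x, ht, hx, hZ, hwt⟩ := exists_circuit_off L.toFinset w hB hex (by
      rw [hw, sform_vecMul_finiteDepthMatrix]
      exact hiso r (by omega) r (by omega))
    have ht : t ∉ L := by simpa using ht
    -- The new circuit fixes `Z` on `L`, so the spans already straightened are undisturbed.
    have hold : ∀ k ≤ r, Submodule.span K
        ((fun i => u i ᵥ* finiteDepthMatrix (gs ++ gs')) '' Set.Iio k) =
        Submodule.span K (pauliZ '' {b | b ∈ L.take k}) := by
      intro k hk
      rw [finiteDepthMatrix_append]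
      simp only [← vecMul_vecMul]
      rw [span_vecMul_image (finiteDepthMatrix gs') (fun i => u i ᵥ* finiteDepthMatrix gs),
        hspan k hk, ← span_vecMul_image]
      congr 1
      refine Set.image_congr fun b hb => hZ b ?_
      simpa using List.mem_of_mem_take hb
    refine ⟨gs ++ gs', L ++ [t], ?_, by simp [hlen], fun k hk => ?_⟩
    · rw [List.nodup_append]
      refine ⟨hL, by simp, ?_⟩
      rintro a ha b hb rfl
      simp only [List.mem_singleton] at hb
      exact ht (hb ▸ ha)
    obtain hk | rfl : k ≤ r ∨ k = r + 1 := by omega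
    · rw [hold k hk, List.take_append_of_le_length (by omega)]
    · have h1 : Set.Iio (r + 1) = insert r (Set.Iio r) := by
        ext; simp only [Set.mem_Iio, Set.mem_insert_iff]; omega
      have h2 : {b | b ∈ (L ++ [t]).take (r + 1)} = insert t {b | b ∈ L} := by
        rw [List.take_of_length_le (by simp [hlen])]
        ext; simp [or_comm]
      have h3 := hold r le_rfl
      rw [List.take_of_length_le hlen.le] at h3
      rw [h1, h2, Set.image_insert_eq, Set.image_insert_eq, Submodule.span_insert,
        Submodule.span_insert, h3, finiteDepthMatrix_append, ← vecMul_vecMul, ← hw, hwt]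
      set V := Submodule.span K ((pauliZ : q → _) '' {b | b ∈ L})
      set y : q ⊕ q → K := ∑ b ∈ L.toFinset, w (.inl b) • pauliZ b
      have hy : y ∈ V := Submodule.sum_mem _ fun b hb => Submodule.smul_mem _ _
        (Submodule.subset_span ⟨b, by simpa using hb, rfl⟩)
      apply le_antisymm
      · refine sup_le ((Submodule.span_singleton_le_iff_mem _ _).mpr ?_) le_sup_right
        exact Submodule.add_mem_sup (Submodule.smul_mem _ _ (Submodule.mem_span_singleton_self _))
          hy
      · refine sup_le ((Submodule.span_singleton_le_iff_mem _ _).mpr ?_) le_sup_right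
        have hv := Submodule.mem_span_singleton_self (R := K) (x • pauliZ t + y)
        have : pauliZ t = x⁻¹ • (x • pauliZ t + y) + (-x⁻¹) • y := by
          rw [smul_add, inv_smul_smul₀ hx, neg_smul, add_neg_cancel_right]
        have hmem := Submodule.add_mem_sup (Submodule.smul_mem _ x⁻¹ hv) (V.smul_mem (-x⁻¹) hy)
        rwa [← this] at hmem

end Prefix

/-! ### Online realization of circuits -/

section Static

variable {l l' τ : Type}

/-- Pauli sequences on two disjoint sets of qubits. -/
def join (w : τ ⊕ τ → K) (v : l ⊕ l → K) : (τ ⊕ l) ⊕ (τ ⊕ l) → K :=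
  Sum.elim (Sum.elim (w ∘ .inl) (v ∘ .inl)) (Sum.elim (w ∘ .inr) (v ∘ .inr))

/-- The part of a Pauli sequence on the first of two sets of qubits. -/
def firstPart (x : (τ ⊕ l) ⊕ (τ ⊕ l) → K) : τ ⊕ τ → K := x ∘ Sum.map .inl .inl

/-- The part of a Pauli sequence on the second of two sets of qubits. -/
def secondPart (x : (τ ⊕ l) ⊕ (τ ⊕ l) → K) : l ⊕ l → K := x ∘ Sum.map .inr .inr

@[simp]
theorem firstPart_join (w : τ ⊕ τ → K) (v : l ⊕ l → K) : firstPart (join w v) = w := by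
  ext (i | i) <;> rfl

@[simp]
theorem secondPart_join (w : τ ⊕ τ → K) (v : l ⊕ l → K) : secondPart (join w v) = v := by
  ext (i | i) <;> rfl

theorem join_first_second (x : (τ ⊕ l) ⊕ (τ ⊕ l) → K) :
    join (firstPart x) (secondPart x) = x := by
  ext ((i | i) | (i | i)) <;> rfl

/-- A sequence with coefficients in `F₂`: it is concentrated in frame `0`. -/
def IsBinary (v : l ⊕ l → K) : Prop := ∀ s, v s ∈ (algebraMap (ZMod 2) K).range

variable [Fintype l] [Fintype l'] [Fintype τ]

/-- A Clifford operation that is applied to each frame separately. -/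
structure IsStatic (F : (l ⊕ l → K) → (l ⊕ l → K)) : Prop where
  linear : IsLinearMap K F
  sform_map : ∀ v w, sform (F v) (F w) = sform v w
  binary : ∀ v, IsBinary v → IsBinary (F v)

theorem sform_join (w w' : τ ⊕ τ → K) (v v' : l ⊕ l → K) :
    sform (join w v) (join w' v') = sform w w' + sform v v' := by
  simp [sform, join]
  ring

theorem IsStatic.comp {F G : (l ⊕ l → K) → (l ⊕ l → K)} (hG : IsStatic G) (hF : IsStatic F) :
    IsStatic (G ∘ F) where
  linear := (hG.linear.mk' _ ∘ₗ hF.linear.mk' _).isLinear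
  sform_map v w := by simp [hG.sform_map, hF.sform_map]
  binary v hv := hG.binary _ (hF.binary _ hv)

theorem IsStatic.join_id {F : (l ⊕ l → K) → (l ⊕ l → K)} (hF : IsStatic F) :
    IsStatic (fun x : (τ ⊕ l) ⊕ (τ ⊕ l) → K => join (firstPart x) (F (secondPart x))) where
  linear := by
    constructor
    · intro x y
      have : F (secondPart (x + y)) = F (secondPart x) + F (secondPart y) := hF.linear.map_add _ _
      rw [this]
      ext ((i | i) | (i | i)) <;> rfl
    · intro a x
      have : F (secondPart (a • x)) = a • F (secondPart x) := hF.linear.map_smul _ _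
      rw [this]
      ext ((i | i) | (i | i)) <;> rfl
  sform_map v w := by
    rw [sform_join, hF.sform_map, ← sform_join, join_first_second, join_first_second]
  binary v hv := by
    have := hF.binary (secondPart v) (fun s => hv _)
    rintro ((i | i) | (i | i))
    exacts [hv _, this _, hv _, this _]

theorem IsStatic.reindex (e : l' ≃ l) {F : (l ⊕ l → K) → (l ⊕ l → K)} (hF : IsStatic F) :
    IsStatic (fun v : l' ⊕ l' → K => F (v ∘ Sum.map e.symm e.symm) ∘ Sum.map e e) where
  linear := by
    constructor
    · intro x y
      have : F ((x + y) ∘ Sum.map e.symm e.symm) = _ :=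
        hF.linear.map_add (x ∘ Sum.map e.symm e.symm) (y ∘ Sum.map e.symm e.symm)
      rw [this]
      rfl
    · intro a x
      have : F ((a • x) ∘ Sum.map e.symm e.symm) = _ :=
        hF.linear.map_smul a (x ∘ Sum.map e.symm e.symm)
      rw [this]
      rfl
  sform_map v w := by
    have key : ∀ (m₁ m₂ : Type) [Fintype m₁] [Fintype m₂] (e : m₁ ≃ m₂) (v w : m₂ ⊕ m₂ → K),
        sform (v ∘ Sum.map e e) (w ∘ Sum.map e e) = sform v w := by
      intro m₁ m₂ _ _ e v w
      refine Fintype.sum_equiv (Equiv.sumCongr e e) _ _ fun s => ?_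
      rcases s with i | i <;> rfl
    rw [key l' l e, hF.sform_map, key l l' e.symm]
  binary v hv := fun s => hF.binary _ (fun s => hv _) _

variable [DecidableEq l]

/-- Clifford operations on a frame are given by symplectic matrices. -/
theorem IsStatic.exists_symplectic {F : (l ⊕ l → K) → (l ⊕ l → K)} (hF : IsStatic F) :
    ∃ U ∈ symplecticGroup l (ZMod 2), ∀ v, v ᵥ* U.map (algebraMap (ZMod 2) K) = F v := by
  have hb : ∀ s t, F (Pi.single s 1) t ∈ (algebraMap (ZMod 2) K).range := by
    intro s
    refine hF.binary _ fun t => ?_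
    rw [Pi.single_apply]
    split_ifs
    · exact one_mem _
    · exact zero_mem _
  choose U hU using hb
  have hU' : ∀ s t, (of U).map (algebraMap (ZMod 2) K) s t = F (Pi.single s 1) t := hU
  refine ⟨of U, ?_, fun v => ?_⟩
  · rw [SymplecticGroup.mem_iff]
    ext s t
    apply (algebraMap (ZMod 2) K).injective
    have h1 := hF.sform_map (Pi.single s 1) (Pi.single t 1)
    have hJ : ∀ a b, J l (ZMod 2) a b = if b = a.swap then 1 else 0 := by
      rintro (a | a) (b | b) <;> simp [J, one_apply, eq_comm]
    rw [mul_apply]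
    simp only [mul_apply, hJ, transpose_apply, mul_ite, mul_one, mul_zero, of_apply, map_sum,
      map_mul]
    rw [sform_single_left] at h1
    have h2 : ∀ b, ∑ a, (if b = a.swap then algebraMap (ZMod 2) K (U s a) else 0)
        = F (Pi.single s 1) b.swap := by
      intro b
      rw [Finset.sum_eq_single b.swap]
      · rw [if_pos (by simp), hU]
      · rintro a - ha
        rw [if_neg]
        rintro rfl
        simp at ha
      · simp
    -- `bar` fixes constants, so on binary sequences the shifted form is the ordinary symplectic
    -- form.
    have h3 : ∀ b, algebraMap (ZMod 2) K (U t b) = bar (F (Pi.single t 1) b) := by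
      intro b
      rw [← hU t b, AlgHom.commutes]
    simp only [apply_ite (algebraMap (ZMod 2) K), map_zero, h2, h3, map_one]
    rw [sform] at h1
    rw [← Equiv.sum_comp (Equiv.sumComm l l)]
    simp only [Equiv.sumComm_apply, Sum.swap_swap]
    rw [h1, Pi.single_apply, one_mul]
    split_ifs with h4 h5 h5
    · simp
    · exact absurd h4.symm h5
    · exact absurd h5.symm h4
    · simp
  · have hv : v = ∑ s, v s • (Pi.single s 1 : l ⊕ l → K) := by
      ext t
      simp [-Fintype.sum_sum_type, Finset.sum_apply, Pi.single_apply]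
    have : F v = ∑ s, v s • F (Pi.single s 1) := by
      conv_lhs => rw [hv]
      change hF.linear.mk' F _ = _
      rw [map_sum]
      simp only [map_smul]
      rfl
    rw [this]
    ext t
    simp only [vecMul, dotProduct, hU', Finset.sum_apply, Pi.smul_apply, smul_eq_mul]

omit [DecidableEq l] in
theorem isStatic_perm (p : Equiv.Perm l) :
    IsStatic (fun v : l ⊕ l → K => v ∘ Sum.map p p) where
  linear := ⟨fun _ _ => rfl, fun _ _ => rfl⟩
  sform_map v w := by
    refine Fintype.sum_equiv (Equiv.sumCongr p p) _ _ fun s => ?_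
    rcases s with i | i <;> rfl
  binary _ hv := fun _ => hv _

theorem isStatic_gate (g : FiniteDepthGate l)
    (hg : ∀ s t, g.toMatrix s t ∈ (algebraMap (ZMod 2) K).range) :
    IsStatic (· ᵥ* g.toMatrix) where
  linear := g.toMatrix.vecMulLinear.isLinear
  sform_map v w := sform_vecMul_gate g v w
  binary _ hv := fun t => sum_mem fun s _ => mul_mem (hv s) (hg s t)

omit [Fintype l] in
theorem one_mem_range (s t : l ⊕ l) :
    (1 : Matrix (l ⊕ l) (l ⊕ l) K) s t ∈ (algebraMap (ZMod 2) K).range := by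
  rw [one_apply]
  split_ifs
  · exact one_mem _
  · exact zero_mem _

omit [Fintype l] in
theorem single_mem_range (a b s t : l ⊕ l) :
    (single a b 1 : Matrix (l ⊕ l) (l ⊕ l) K) s t ∈ (algebraMap (ZMod 2) K).range := by
  rw [single_apply]
  split_ifs
  · exact one_mem _
  · exact zero_mem _

theorem isStatic_hadamard (i : l) : IsStatic (· ᵥ* (FiniteDepthGate.hadamard i).toMatrix) :=
  isStatic_gate _ fun _ _ => one_mem_range _ _

theorem isStatic_phase (i : l) : IsStatic (· ᵥ* (FiniteDepthGate.phase i).toMatrix) :=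
  isStatic_gate _ fun _ _ => add_mem (one_mem_range _ _) (single_mem_range _ _ _ _)

theorem isStatic_cnot (i j : l) (hij : i ≠ j) :
    IsStatic (· ᵥ* (FiniteDepthGate.cnot i j hij 0).toMatrix) :=
  isStatic_gate _ fun s t => by
    simp only [FiniteDepthGate.toMatrix, neg_zero, zpow_zero]
    exact add_mem (add_mem (one_mem_range _ _) (single_mem_range _ _ _ _))
      (single_mem_range _ _ _ _)

theorem isStatic_cphase (i j : l) (hij : i ≠ j) :
    IsStatic (· ᵥ* (FiniteDepthGate.cphase i j hij 0).toMatrix) :=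
  isStatic_gate _ fun s t => by
    simp only [FiniteDepthGate.toMatrix, neg_zero, zpow_zero]
    exact add_mem (add_mem (one_mem_range _ _) (single_mem_range _ _ _ _))
      (single_mem_range _ _ _ _)

end Static

/-! ### Memory, feedback and delays -/

section Online

variable {q : Type} [Fintype q] [DecidableEq q]

/-- A transformation of Pauli sequences that can be run online without latency. -/
def OnlineMap (F : (q ⊕ q → K) → (q ⊕ q → K)) : Prop :=
  ∃ (σ : Type) (_ : Fintype σ) (_ : DecidableEq σ)
    (G : ((σ ⊕ q) ⊕ (σ ⊕ q) → K) → ((σ ⊕ q) ⊕ (σ ⊕ q) → K)), IsStatic G ∧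
      ∀ v, ∃ w : σ ⊕ σ → K, G (join (D • w) v) = join w (F v)

theorem isOnline_of_onlineMap {M : Matrix (q ⊕ q) (q ⊕ q) K} (d : ℕ)
    (h : OnlineMap fun v => D ^ d • (v ᵥ* M)) : IsOnline M := by
  obtain ⟨σ, _, _, G, hG, hw⟩ := h
  let e : Fin (Fintype.card σ) ⊕ q ≃ σ ⊕ q :=
    Equiv.sumCongr (Fintype.equivFin σ).symm (Equiv.refl q)
  obtain ⟨U, hU, hUG⟩ := (hG.reindex e).exists_symplectic
  refine ⟨Fintype.card σ, d, U, hU, fun v => ?_⟩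
  obtain ⟨w, hw⟩ := hw v
  refine ⟨w ∘ Sum.map (Fintype.equivFin σ).symm (Fintype.equivFin σ).symm, ?_⟩
  rw [hUG]
  have h1 : withMemory (D • w ∘ Sum.map (Fintype.equivFin σ).symm (Fintype.equivFin σ).symm) v ∘
      Sum.map e.symm e.symm = join (D • w) v := by
    ext ((i | i) | (i | i)) <;> simp [withMemory, join, e]
  rw [h1, hw]
  ext ((i | i) | (i | i)) <;> rfl

omit [DecidableEq q] in
-- Qubits whose output returns as input one frame later are simply further memory. It suffices to
-- exhibit a solution `w` of the loop equation for each input; this is where rational transfer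
-- functions enter.
theorem OnlineMap.feedback {τ : Type} [Fintype τ] [DecidableEq τ]
    {F' : ((τ ⊕ q) ⊕ (τ ⊕ q) → K) → ((τ ⊕ q) ⊕ (τ ⊕ q) → K)} (hF' : OnlineMap F')
    {F : (q ⊕ q → K) → (q ⊕ q → K)}
    (h : ∀ v, ∃ w : τ ⊕ τ → K, F' (join (D • w) v) = join w (F v)) : OnlineMap F := by
  obtain ⟨σ, _, _, G, hG, hw⟩ := hF'
  refine ⟨σ ⊕ τ, inferInstance, inferInstance, _, hG.reindex (Equiv.sumAssoc σ τ q), fun v => ?_⟩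
  obtain ⟨w₂, h₂⟩ := h v
  obtain ⟨w₁, h₁⟩ := hw (join (D • w₂) v)
  refine ⟨join w₁ w₂, ?_⟩
  have : join (D • join w₁ w₂) v ∘
      Sum.map (Equiv.sumAssoc σ τ q).symm (Equiv.sumAssoc σ τ q).symm =
      join (D • w₁) (join (D • w₂) v) := by
    ext ((i | i | i) | (i | i | i)) <;> rfl
  rw [this, h₁, h₂]
  ext (((i | i) | i) | ((i | i) | i)) <;> rfl

omit [DecidableEq q] in
theorem IsStatic.onlineMap {F : (q ⊕ q → K) → (q ⊕ q → K)} (hF : IsStatic F) : OnlineMap F :=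
  ⟨Empty, inferInstance, inferInstance, _, hF.join_id, fun v => ⟨0, by simp⟩⟩

omit [DecidableEq q] in
-- Both steps are run one after the other within a single frame, each on its own memory.
theorem OnlineMap.comp {F₁ F₂ : (q ⊕ q → K) → (q ⊕ q → K)} (h₂ : OnlineMap F₂)
    (h₁ : OnlineMap F₁) : OnlineMap (F₂ ∘ F₁) := by
  obtain ⟨σ₁, _, _, G₁, hG₁, hw₁⟩ := h₁
  obtain ⟨σ₂, _, _, G₂, hG₂, hw₂⟩ := h₂
  let e₁ : (σ₁ ⊕ σ₂) ⊕ q ≃ σ₂ ⊕ (σ₁ ⊕ q) :=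
    (Equiv.sumCongr (Equiv.sumComm _ _) (Equiv.refl _)).trans (Equiv.sumAssoc _ _ _)
  let e₂ : (σ₁ ⊕ σ₂) ⊕ q ≃ σ₁ ⊕ (σ₂ ⊕ q) := Equiv.sumAssoc _ _ _
  refine ⟨σ₁ ⊕ σ₂, inferInstance, inferInstance, _,
    ((hG₂.join_id (τ := σ₁)).reindex e₂).comp ((hG₁.join_id (τ := σ₂)).reindex e₁), fun v => ?_⟩
  obtain ⟨w₁, h₁⟩ := hw₁ v
  obtain ⟨w₂, h₂⟩ := hw₂ (F₁ v)
  refine ⟨join w₁ w₂, ?_⟩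
  have c₁ : join (D • join w₁ w₂) v ∘ Sum.map e₁.symm e₁.symm =
      join (D • w₂) (join (D • w₁) v) := by
    ext ((i | i | i) | (i | i | i)) <;> rfl
  have c₂ : (join (D • w₂) (join w₁ (F₁ v)) ∘ Sum.map e₁ e₁) ∘ Sum.map e₂.symm e₂.symm =
      join w₁ (join (D • w₂) (F₁ v)) := by
    ext ((i | i | i) | (i | i | i)) <;> rfl
  simp only [Function.comp_apply]
  rw [c₁, firstPart_join, secondPart_join, h₁, c₂, firstPart_join, secondPart_join, h₂]
  ext (((i | i) | i) | ((i | i) | i)) <;> rfl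

/-- The transformation that delays qubit `i` by `e i` frames. -/
def delay (e : q → ℕ) (v : q ⊕ q → K) : q ⊕ q → K := fun s => D ^ e (qubit s) * v s

/-- A delay by one frame swaps the qubit with a memory qubit. Delay vectors that can be realized
form a submonoid, so these generators suffice. -/
theorem onlineMap_delay (e : q → ℕ) : OnlineMap (delay e) := by
  let A : AddSubmonoid (q → ℕ) :=
    { carrier := {e | OnlineMap (delay e)}
      zero_mem' := by
        have : (delay (0 : q → ℕ)) = fun v : q ⊕ q → K => v ∘ Sum.map (1 : Equiv.Perm q)
            (1 : Equiv.Perm q) := by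
          ext v (i | i) <;> simp [delay]
        change OnlineMap _
        rw [this]
        exact (isStatic_perm 1).onlineMap
      add_mem' := by
        intro e f he hf
        have : delay (e + f) = delay e ∘ delay f := by
          ext v s
          simp [delay, pow_add, mul_assoc]
        change OnlineMap _
        rw [this]
        exact he.comp hf }
  have hA : ∀ i, Pi.single i 1 ∈ A := by
    intro i
    change OnlineMap _
    let p : Equiv.Perm (Unit ⊕ q) := Equiv.swap (.inl ()) (.inr i)
    refine (isStatic_perm p).onlineMap.feedback fun v => ⟨v ∘ Sum.map (fun _ => i) (fun _ => i), ?_⟩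
    ext ((j | j) | (j | j))
    · simp [join, p]
    · by_cases h : j = i
      · subst h; simp [join, p, delay]
      · simp [join, p, delay, h, Equiv.swap_apply_of_ne_of_ne]
    · simp [join, p]
    · by_cases h : j = i
      · subst h; simp [join, p, delay]
      · simp [join, p, delay, h, Equiv.swap_apply_of_ne_of_ne]
  have he : e = ∑ i, e i • Pi.single i 1 := by
    ext j
    simp [Finset.sum_apply, Pi.single_apply]
  change e ∈ A
  rw [he]
  exact sum_mem fun i _ => nsmul_mem (hA i) _

/-- `M` can be run online up to a finite latency. -/
def OnlineUpToDelay (M : Matrix (q ⊕ q) (q ⊕ q) K) : Prop :=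
  ∃ d : ℕ, OnlineMap fun v => D ^ d • (v ᵥ* M)

omit [DecidableEq q] in
theorem OnlineUpToDelay.mul {M N : Matrix (q ⊕ q) (q ⊕ q) K} (hM : OnlineUpToDelay M)
    (hN : OnlineUpToDelay N) : OnlineUpToDelay (M * N) := by
  obtain ⟨d, hd⟩ := hM
  obtain ⟨d', hd'⟩ := hN
  refine ⟨d' + d, ?_⟩
  convert hd'.comp hd using 1
  ext v s
  simp [pow_add, smul_vecMul, vecMul_vecMul, mul_assoc]

omit [DecidableEq q] in
theorem OnlineUpToDelay.of_static {M : Matrix (q ⊕ q) (q ⊕ q) K} (h : IsStatic (· ᵥ* M)) :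
    OnlineUpToDelay M :=
  ⟨0, by simpa using h.onlineMap⟩

/-- A gate between two qubits in the same frame, conjugated by delays, acts between qubits of
different frames. -/
theorem onlineUpToDelay_two_qubit {i j : q} (hij : i ≠ j) {s₁ t₁ s₂ t₂ : q ⊕ q}
    (hs₁ : qubit s₁ = i) (ht₁ : qubit t₁ = j) (hs₂ : qubit s₂ = j) (ht₂ : qubit t₂ = i) (m : ℤ)
    {M₀ M : Matrix (q ⊕ q) (q ⊕ q) K} (h₀ : IsStatic (· ᵥ* M₀))
    (hM₀ : ∀ v, v ᵥ* M₀ = v + Pi.single t₁ (v s₁) + Pi.single t₂ (v s₂))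
    (hM : ∀ v, v ᵥ* M = v + Pi.single t₁ (v s₁ * D ^ m) + Pi.single t₂ (v s₂ * D ^ (-m))) :
    OnlineUpToDelay M := by
  have hD := D_ne_zero
  -- Delays `e` before the gate put the two qubits at relative offset `m`; delays `d - e k`
  -- afterwards realign all qubits at the common latency `d`.
  obtain ⟨d, e, hed, he⟩ : ∃ (d : ℕ) (e : q → ℕ), (∀ k, e k ≤ d) ∧ (e i : ℤ) - e j = m := by
    refine ⟨m.natAbs, fun k => if k = i then m.toNat else if k = j then (-m).toNat else 0,
      fun k => ?_, ?_⟩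
    · dsimp only
      split_ifs <;> omega
    · simp only [if_true, hij.symm, if_false]
      omega
  refine ⟨d, ?_⟩
  convert (onlineMap_delay fun k => d - e k).comp (h₀.onlineMap.comp (onlineMap_delay e)) using 1
  have hk : ∀ k, (D : K) ^ (d - e k) * D ^ e k = D ^ d := fun k => by
    rw [← pow_add, Nat.sub_add_cancel (hed k)]
  have h1 : (D : K) ^ (d - e j) * D ^ e i = D ^ d * D ^ m := by
    simp only [← zpow_natCast]
    rw [← zpow_add₀ hD, ← zpow_add₀ hD, Nat.cast_sub (hed j)]
    congr 1
    omega
  have h2 : (D : K) ^ (d - e i) * D ^ e j = D ^ d * D ^ (-m) := by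
    simp only [← zpow_natCast]
    rw [← zpow_add₀ hD, ← zpow_add₀ hD, Nat.cast_sub (hed i)]
    congr 1
    omega
  ext v s
  simp only [Function.comp_apply, hM, hM₀, delay, Pi.smul_apply, Pi.add_apply, Pi.single_apply,
    hs₁, hs₂, smul_eq_mul, mul_add]
  rw [← mul_assoc, hk]
  congr 1
  · congr 1
    split_ifs with h
    · rw [h, ht₁]
      linear_combination -(v s₁) * h1
    · simp
  · split_ifs with h
    · rw [h, ht₂]
      linear_combination -(v s₂) * h2
    · simp

/-- Qubit `i` sits in a delay line of total length `n + 1`. A controlled-phase gate couples the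
frame that leaves the line to the frame that enters it, and a swap exchanges the two. Each frame is
thus coupled to both neighbours at distance `n + 1`. -/
theorem onlineUpToDelay_selfCphase (i : q) (n : ℕ) (hm : ((n + 1 : ℕ) : ℤ) ≠ 0) :
    OnlineUpToDelay (FiniteDepthGate.selfCphase i ((n + 1 : ℕ) : ℤ) hm).toMatrix := by
  have hD := D_ne_zero
  let p : Equiv.Perm (Unit ⊕ q) := Equiv.swap (.inl ()) (.inr i)
  have hM : ∀ v : q ⊕ q → K,
      v ᵥ* (FiniteDepthGate.selfCphase i ((n + 1 : ℕ) : ℤ) hm).toMatrix =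
        v + Pi.single (.inl i) (v (.inr i) * (D ^ (n + 1) + (D ^ (n + 1))⁻¹)) := fun v => by
    rw [vecMul_selfCphase, _root_.zpow_neg, zpow_natCast]
  let F : (q ⊕ q → K) → (q ⊕ q → K) := fun v s => if qubit s = i then D ^ (n + 1) *
    (v + Pi.single (.inl i) (v (.inr i) * (D ^ (n + 1) + (D ^ (n + 1))⁻¹)) : q ⊕ q → K) s else v s
  have hF : OnlineMap F := by
    refine ((isStatic_perm p).onlineMap.comp ((isStatic_cphase (.inl ()) (.inr i)
      (by simp)).onlineMap.comp (onlineMap_delay (Sum.elim (fun _ => n) 0)))).feedback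
      -- The frame is stored after its coupling with the older frame and before that with the
      -- younger one.
      fun v => ⟨Sum.elim (fun _ => v (.inl i) + D ^ (n + 1) * v (.inr i)) (fun _ => v (.inr i)), ?_⟩
    ext ((j | j) | (j | j))
    · simp [join, p, delay]
      ring
    · by_cases h : j = i
      · subst h
        simp [join, p, delay, F]
        field_simp
        ring
      · simp [join, p, delay, F, h, Equiv.swap_apply_of_ne_of_ne]
    · simp [join, p, delay]
    · by_cases h : j = i
      · subst h
        simp [join, p, delay, F]
        ring
      · simp [join, p, delay, F, h, Equiv.swap_apply_of_ne_of_ne]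
  refine ⟨n + 1, ?_⟩
  simp only [hM]
  convert (onlineMap_delay fun k => if k = i then 0 else n + 1).comp hF using 1
  ext v s
  by_cases h : qubit s = i
  · simp [delay, F, h]
  · have : s ≠ .inl i := by rintro rfl; exact h rfl
    simp [delay, F, h, this]

theorem onlineUpToDelay_finiteDepth (g : FiniteDepthGate q) : OnlineUpToDelay g.toMatrix := by
  cases g with
  | hadamard i => exact .of_static (isStatic_hadamard i)
  | phase i => exact .of_static (isStatic_phase i)
  | cnot i j hij m =>
    exact onlineUpToDelay_two_qubit (s₁ := .inr i) (t₁ := .inr j) (s₂ := .inl j) (t₂ := .inl i)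
      hij rfl rfl rfl rfl m (isStatic_cnot i j hij) (fun v => by simp) (fun v => vecMul_cnot ..)
  | cphase i j hij m =>
    exact onlineUpToDelay_two_qubit (s₁ := .inr i) (t₁ := .inl j) (s₂ := .inr j) (t₂ := .inl i)
      hij rfl rfl rfl rfl m (isStatic_cphase i j hij) (fun v => by simp)
      (fun v => vecMul_cphase ..)
  | selfCphase i m hm =>
    obtain ⟨n, rfl | rfl⟩ : ∃ n : ℕ, m = (n + 1 : ℕ) ∨ m = -((n + 1 : ℕ) : ℤ) :=
      ⟨m.natAbs - 1, by omega⟩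
    · exact onlineUpToDelay_selfCphase i n _
    · convert onlineUpToDelay_selfCphase i n (by omega) using 1
      simp only [FiniteDepthGate.toMatrix, neg_neg, add_comm (D ^ (-((n + 1 : ℕ) : ℤ)))]

/-! #### The infinite-depth operation -/

/-- Adding `p(D)` times the `X` part of the memory qubit to qubit `i`, while the memory qubit is
delayed by `r` frames. -/
def tap (i : q) (p : Polynomial (ZMod 2)) (r : ℕ) (x : (Unit ⊕ q) ⊕ (Unit ⊕ q) → K) :
    (Unit ⊕ q) ⊕ (Unit ⊕ q) → K :=
  delay (Sum.elim (fun _ => r) 0) (x +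
    Pi.single (.inr (.inr i)) (algebraMap _ K p * x (.inr (.inl ()))) +
    Pi.single (.inl (.inl ())) (bar (algebraMap _ K p) * x (.inl (.inr i))))

/-- Horner's scheme: each coefficient of `p` is a CNOT or nothing within the frame, followed by one
delay of the memory qubit. As `r` exceeds the degree, the delay also makes the backward action
`p(D⁻¹)` causal. -/
theorem onlineMap_tap (i : q) (r : ℕ) (p : Polynomial (ZMod 2)) (hp : p.degree < r) :
    OnlineMap (tap i p r) := by
  have hD := D_ne_zero
  induction r generalizing p with
  | zero =>
    obtain rfl : p = 0 := by
      rw [← Polynomial.degree_eq_bot]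
      simpa using hp
    convert onlineMap_delay (q := Unit ⊕ q) 0 using 1
    ext x s
    rcases s with (j | j) | (j | j) <;> simp [tap, delay]
  | succ r ih =>
    have hdiv : p.divX.degree < r := by
      rw [Polynomial.degree_lt_iff_coeff_zero] at hp ⊢
      intro m hm
      rw [Polynomial.coeff_divX]
      exact hp _ (by omega)
    have hstep : OnlineMap (fun x : (Unit ⊕ q) ⊕ (Unit ⊕ q) → K =>
        x + Pi.single (.inr (.inr i)) (algebraMap (ZMod 2) K (p.coeff 0) * x (.inr (.inl ())))
        + Pi.single (.inl (.inl ())) (algebraMap (ZMod 2) K (p.coeff 0) * x (.inl (.inr i)))) := by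
      obtain h | h : p.coeff 0 = 0 ∨ p.coeff 0 = 1 := by
        generalize p.coeff 0 = b
        revert b; decide
      · convert onlineMap_delay (q := Unit ⊕ q) 0 using 1
        ext x s
        simp [delay, h]
      · convert (isStatic_cnot (.inl ()) (.inr i : Unit ⊕ q) (by simp)).onlineMap using 1
        ext x s
        simp [h]
    convert (ih _ hdiv).comp ((onlineMap_delay (Sum.elim (fun _ => 1) 0)).comp hstep) using 1
    have hpK : algebraMap _ K p =
        D * algebraMap _ K p.divX + algebraMap (ZMod 2) K (p.coeff 0) := by
      conv_lhs => rw [← Polynomial.X_mul_divX_add p]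
      rw [map_add, map_mul, RatFunc.algebraMap_X]
      rfl
    have hpb : bar (algebraMap _ K p) =
        D⁻¹ * bar (algebraMap _ K p.divX) + algebraMap (ZMod 2) K (p.coeff 0) := by
      rw [hpK, map_add, map_mul, bar_D, AlgHom.commutes]
    ext x s
    rcases s with (j | j) | (j | j)
    · simp [tap, delay, hpb]
      field_simp
      ring
    · simp [tap, delay]
    · simp [tap, delay]
      ring
    · by_cases h : j = i
      · subst h
        simp [tap, delay, hpK]
        ring
      · simp [tap, delay, h]

/-- Splitting off the lowest power of `D` leaves constant term `1`, the only nonzero element of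
`F₂`. The inverse of the remaining factor can then be computed by a feedback loop that contains a
delay. -/
theorem IsLaurent.exists_eq_zpow_mul {f : K} (hf : IsLaurent f) (hf0 : f ≠ 0) :
    ∃ (m : ℤ) (p : Polynomial (ZMod 2)), f = D ^ m * (1 + D * algebraMap _ K p) := by
  obtain ⟨p, m, rfl⟩ := hf
  have hp : p ≠ 0 := by rintro rfl; simp at hf0
  obtain ⟨g, hg, hdvd⟩ := p.exists_eq_pow_rootMultiplicity_mul_and_not_dvd hp 0
  rw [map_zero, sub_zero] at hg hdvd
  rw [Polynomial.X_dvd_iff] at hdvd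
  have hg0 : g.coeff 0 = 1 := by
    generalize g.coeff 0 = b at hdvd
    revert b; decide
  have hgK : algebraMap _ K g = 1 + D * algebraMap _ K g.divX := by
    conv_lhs => rw [← Polynomial.X_mul_divX_add g, hg0]
    rw [map_add, map_mul, RatFunc.algebraMap_X, map_one, map_one, add_comm]
  refine ⟨(p.rootMultiplicity 0 : ℤ) - m, g.divX, ?_⟩
  conv_lhs => rw [hg]
  rw [map_mul, map_pow, RatFunc.algebraMap_X, hgK, zpow_sub₀ D_ne_zero, zpow_natCast, zpow_natCast]
  ring

/-- Polynomial division by a shift register: in characteristic 2 the quotient `w = g⁻¹ x` with `g =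
1 + D p` solves `w = x + p D w`. The backward action of the same taps multiplies the Z part by `bar
g`, up to delay. -/
theorem onlineUpToDelay_infiniteDepth (i : q) (f : K) (hf : IsLaurent f) (hf0 : f ≠ 0) :
    OnlineUpToDelay (Gate.infiniteDepth i f hf hf0).toMatrix := by
  have hD := D_ne_zero
  obtain ⟨m, p, hfp⟩ := hf.exists_eq_zpow_mul hf0
  set g : K := 1 + D * algebraMap _ K p with hg
  have hg0 : g ≠ 0 := by rintro h; rw [hfp, h, mul_zero] at hf0; exact hf0 rfl
  obtain ⟨r, hr⟩ : ∃ r : ℕ, p.degree < r :=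
    ⟨p.natDegree + 1, Polynomial.degree_le_natDegree.trans_lt
      (by exact_mod_cast Nat.lt_succ_self _)⟩
  let perm : Equiv.Perm (Unit ⊕ q) := Equiv.swap (.inl ()) (.inr i)
  let F : (q ⊕ q → K) → (q ⊕ q → K) := fun v => Sum.elim
    (fun j => if j = i then D ^ (r + 1) * bar g * v (.inl j) else v (.inl j))
    (fun j => if j = i then D ^ (r + 1) * g⁻¹ * v (.inr j) else v (.inr j))
  have hF : OnlineMap F := by
    refine ((isStatic_perm perm).onlineMap.comp (onlineMap_tap i r p hr)).feedback
      fun v => ⟨Sum.elim (fun _ => v (.inl i)) (fun _ => g⁻¹ * v (.inr i)), ?_⟩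
    ext ((j | j) | (j | j))
    · simp [join, perm, tap, delay]
    · by_cases h : j = i
      · subst h
        simp [join, perm, tap, delay, F, hg]
        field_simp
        ring
      · simp [join, perm, tap, delay, F, h, Equiv.swap_apply_of_ne_of_ne]
    · have : v (.inr i) + algebraMap _ K p * (D * (g⁻¹ * v (.inr i))) = g⁻¹ * v (.inr i) := by
        field_simp
        rw [hg]
        linear_combination v (.inr i) * add_self (D * algebraMap _ K p)
      simpa [join, perm, tap, delay] using this
    · by_cases h : j = i
      · subst h
        simp [join, perm, tap, delay, F]
        ring
      · simp [join, perm, tap, delay, F, h, Equiv.swap_apply_of_ne_of_ne]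
  obtain ⟨a, b, hab⟩ : ∃ a b : ℕ, (b : ℤ) = a - m := ⟨m.natAbs, (m.natAbs - m).toNat, by omega⟩
  have hpow : (D : K) ^ b = D ^ a * (D ^ m)⁻¹ := by
    rw [← zpow_natCast, hab, zpow_sub₀ hD, zpow_natCast, div_eq_mul_inv]
  refine ⟨r + 1 + a, ?_⟩
  convert (onlineMap_delay fun k => if k = i then b else r + 1 + a).comp hF using 1
  ext v (j | j)
  · by_cases h : j = i
    · subst h
      simp [vecMul_infiniteDepth, delay, F, hfp, hpow]
      ring
    · simp [vecMul_infiniteDepth, delay, F, h]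
  · by_cases h : j = i
    · subst h
      simp [vecMul_infiniteDepth, delay, F, hfp, hpow]
      ring
    · simp [vecMul_infiniteDepth, delay, F, h]

theorem isOnline_circuitMatrix (gs : List (Gate q)) : IsOnline (circuitMatrix gs) := by
  obtain ⟨d, hd⟩ : OnlineUpToDelay (circuitMatrix gs) := by
    induction gs with
    | nil =>
      refine .of_static ?_
      simpa [Function.comp_def] using isStatic_perm (1 : Equiv.Perm q)
    | cons g gs ih =>
      rw [circuitMatrix_cons]
      refine OnlineUpToDelay.mul ?_ ih
      cases g with
      | finiteDepth g => exact onlineUpToDelay_finiteDepth g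
      | infiniteDepth i f hf hf0 => exact onlineUpToDelay_infiniteDepth i f hf hf0
  exact isOnline_of_onlineMap d hd

end Online

/-! ### Circuits on a part of the qubits -/

section Push

variable {q q' : Type} [Fintype q] [DecidableEq q] [Fintype q'] [DecidableEq q']

/-- A Pauli sequence on some of the qubits as one on all of them. -/
def push (e : q ↪ q') : (q ⊕ q → K) →ₗ[K] (q' ⊕ q' → K) :=
  Function.ExtendByZero.linearMap K (Sum.map e e)

omit [Fintype q] [DecidableEq q] [Fintype q'] [DecidableEq q'] in
theorem push_comp (e : q ↪ q') (v : q ⊕ q → K) : push e v ∘ Sum.map e e = v := by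
  ext s
  exact (e.injective.sumMap e.injective).extend_apply v 0 s

omit [Fintype q] [DecidableEq q] [Fintype q'] [DecidableEq q'] in
theorem push_apply_of_notMem (e : q ↪ q') (v : q ⊕ q → K) {s : q' ⊕ q'}
    (hs : s ∉ Set.range (Sum.map e e)) : push e v s = 0 :=
  Function.extend_apply' v (0 : q' ⊕ q' → K) s hs

omit [Fintype q] [Fintype q'] in
theorem push_single (e : q ↪ q') (s : q ⊕ q) (x : K) :
    push e (Pi.single s x) = Pi.single (Sum.map e e s) x := by
  have hinj : Function.Injective (Sum.map e e) := e.injective.sumMap e.injective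
  ext t
  by_cases ht : t ∈ Set.range (Sum.map e e)
  · obtain ⟨t, rfl⟩ := ht
    rw [← Function.comp_apply (f := push e _), push_comp, Pi.single_apply, Pi.single_apply]
    simp only [hinj.eq_iff]
  · rw [push_apply_of_notMem e _ ht, Pi.single_eq_of_ne]
    rintro rfl
    exact ht ⟨s, rfl⟩

omit [Fintype q] [Fintype q'] in
@[simp]
theorem push_pauliZ (e : q ↪ q') (i : q) : push e (pauliZ i) = pauliZ (e i) := push_single ..

omit [Fintype q] [Fintype q'] in
@[simp]
theorem push_pauliX (e : q ↪ q') (i : q) : push e (pauliX i) = pauliX (e i) := push_single ..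

theorem push_vecMul_circuit (e : q ↪ q') (gs : List (Gate q)) (v : q ⊕ q → K) :
    push e v ᵥ* circuitMatrix (gs.map (Gate.map e)) = push e (v ᵥ* circuitMatrix gs) := by
  obtain ⟨h1, h2⟩ := vecMul_map_circuit e gs (push e v)
  rw [push_comp] at h1
  ext s
  by_cases hs : s ∈ Set.range (Sum.map e e)
  · obtain ⟨s, rfl⟩ := hs
    rw [← Function.comp_apply (f := push e _), push_comp]
    exact congrFun h1 s
  · rw [h2 s hs, push_apply_of_notMem e _ hs, push_apply_of_notMem e _ hs]

theorem vecMul_circuit_of_comp_eq_zero (e : q ↪ q') (gs : List (Gate q)) {v : q' ⊕ q' → K}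
    (hv : v ∘ Sum.map e e = 0) : v ᵥ* circuitMatrix (gs.map (Gate.map e)) = v := by
  obtain ⟨h1, h2⟩ := vecMul_map_circuit e gs v
  rw [hv, zero_vecMul] at h1
  ext s
  by_cases hs : s ∈ Set.range (Sum.map e e)
  · obtain ⟨s, rfl⟩ := hs
    exact (congrFun h1 s).trans (congrFun hv s).symm
  · exact h2 s hs

omit [Fintype q] [DecidableEq q] [Fintype q'] [DecidableEq q'] in
theorem map_finiteDepth_map (e : q ↪ q') (gs : List (FiniteDepthGate q)) :
    (gs.map Gate.finiteDepth).map (Gate.map e)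
      = (gs.map (FiniteDepthGate.map e)).map Gate.finiteDepth := by
  rw [List.map_map, List.map_map]
  rfl

theorem push_vecMul_finiteDepth (e : q ↪ q') (gs : List (FiniteDepthGate q)) (v : q ⊕ q → K) :
    push e v ᵥ* finiteDepthMatrix (gs.map (FiniteDepthGate.map e))
      = push e (v ᵥ* finiteDepthMatrix gs) := by
  have := push_vecMul_circuit e (gs.map Gate.finiteDepth) v
  rwa [map_finiteDepth_map] at this

theorem vecMul_finiteDepth_of_comp_eq_zero (e : q ↪ q') (gs : List (FiniteDepthGate q))
    {v : q' ⊕ q' → K} (hv : v ∘ Sum.map e e = 0) :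
    v ᵥ* finiteDepthMatrix (gs.map (FiniteDepthGate.map e)) = v := by
  have := vecMul_circuit_of_comp_eq_zero e (gs.map Gate.finiteDepth) hv
  rwa [map_finiteDepth_map] at this

end Push

/-! ### Controlled operations with Laurent polynomial coefficients -/

section Shear

variable {C T : Type} [Fintype C] [DecidableEq C] [Fintype T] [DecidableEq T]

/-- `M` adds `u i` times the `X` part of the control qubit `i` to the target qubits. -/
structure IsShear (u : C → T ⊕ T → K) (M : Matrix ((C ⊕ T) ⊕ (C ⊕ T)) ((C ⊕ T) ⊕ (C ⊕ T)) K) :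
    Prop where
  vecMul_eq : ∀ v, ∃ y : C → K, v ᵥ* M =
    v + join 0 (∑ i, v (.inr (.inl i)) • u i) + ∑ i, y i • pauliZ (.inl i)
  vecMul_pauliZ : ∀ i, pauliZ (.inl i) ᵥ* M = pauliZ (.inl i)

omit [DecidableEq C] [DecidableEq T] [Fintype C] [Fintype T] in
theorem join_add (w w' : C ⊕ C → K) (v v' : T ⊕ T → K) :
    join (w + w') (v + v') = join w v + join w' v' := by
  ext ((i | i) | (i | i)) <;> rfl

/-- A shear leaves the X part of the controls alone, so the second one reads the same coefficients.
The back-action on the Z part of the controls is left arbitrary in `IsShear`, so it needs no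
bookkeeping. -/
theorem IsShear.mul {u u' : C → T ⊕ T → K} {M M' : Matrix _ _ K} (h : IsShear u M)
    (h' : IsShear u' M') : IsShear (u + u') (M * M') where
  vecMul_eq v := by
    obtain ⟨y, hy⟩ := h.vecMul_eq v
    obtain ⟨y', hy'⟩ := h'.vecMul_eq (v ᵥ* M)
    refine ⟨y + y', ?_⟩
    have hx : ∀ i, (v ᵥ* M) (.inr (.inl i)) = v (.inr (.inl i)) := by
      intro i
      simp [hy, join, pauliZ, Finset.sum_apply]
    rw [← vecMul_vecMul, hy']
    simp only [hx]
    rw [hy]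
    have : join (0 : C ⊕ C → K) (∑ i, v (.inr (.inl i)) • (u + u') i) =
        join 0 (∑ i, v (.inr (.inl i)) • u i) + join 0 (∑ i, v (.inr (.inl i)) • u' i) := by
      rw [← join_add, add_zero, ← Finset.sum_add_distrib]
      simp only [Pi.add_apply, smul_add]
    rw [this]
    simp only [Pi.add_apply, add_smul, Finset.sum_add_distrib]
    abel
  vecMul_pauliZ i := by rw [← vecMul_vecMul, h.vecMul_pauliZ, h'.vecMul_pauliZ]

omit [Fintype T] [Fintype C] in
theorem join_zero_single (s : T ⊕ T) (x : K) :
    join (0 : C ⊕ C → K) (Pi.single s x) = Pi.single (Sum.map .inr .inr s) x := by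
  ext ((i | i) | (i | i)) <;> rcases s with j | j <;> simp [join, Pi.single_apply]

omit [Fintype T] in
theorem sum_smul_single_single (i : C) (s : T ⊕ T) (x : K) (z : C → K) :
    ∑ j, z j • (Pi.single i (Pi.single s x) : C → T ⊕ T → K) j = Pi.single s (z i * x) := by
  rw [Finset.sum_eq_single i]
  · ext t; simp [Pi.single_apply]
  · intro j _ hj
    simp [hj]
  · simp

/-- Shears with Laurent polynomial coefficients are finite-depth. -/
theorem exists_circuit_isShear (u : C → T ⊕ T → K) (hu : ∀ i s, IsLaurent (u i s)) :
    ∃ gs : List (FiniteDepthGate (C ⊕ T)), IsShear u (finiteDepthMatrix gs) := by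
  let A : AddSubmonoid (C → T ⊕ T → K) :=
    { carrier := {u | ∃ gs : List (FiniteDepthGate (C ⊕ T)), IsShear u (finiteDepthMatrix gs)}
      zero_mem' := ⟨[], ⟨fun v => ⟨0, by
        have : join (0 : C ⊕ C → K) (0 : T ⊕ T → K) = 0 := by ext ((i | i) | (i | i)) <;> rfl
        simp [this]⟩, by simp⟩⟩
      add_mem' := by
        rintro u u' ⟨gs, h⟩ ⟨gs', h'⟩
        exact ⟨gs ++ gs', by rw [finiteDepthMatrix_append]; exact h.mul h'⟩ }
  have hA : ∀ i s f, IsLaurent f → Pi.single i (Pi.single s f) ∈ A := by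
    intro i s f hf
    -- Additivity reduces to monomials, each of which is one gate: controlled phase for a Z entry,
    -- CNOT for an X entry.
    refine IsLaurent.induction (P := fun f => Pi.single i (Pi.single s f) ∈ A) ?_ ?_ ?_ hf
    · simp
    · intro f g hf hg
      rw [Pi.single_add, Pi.single_add]
      exact A.add_mem hf hg
    · intro m
      rcases s with k | k
      · refine ⟨[.cphase (.inl i) (.inr k) (by simp) m], ⟨fun v => ⟨Pi.single i
          (v (.inr (.inr k)) * D ^ (-m)), ?_⟩, fun j => ?_⟩⟩
        · rw [finiteDepthMatrix_singleton, vecMul_cphase, sum_smul_single_single, join_zero_single]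
          congr 1
          rw [Finset.sum_eq_single i]
          · ext t; simp [pauliZ, Pi.single_apply]
          · intro j _ hj; simp [hj]
          · simp
        · rw [finiteDepthMatrix_singleton, vecMul_cphase]
          simp [pauliZ]
      · refine ⟨[.cnot (.inl i) (.inr k) (by simp) m], ⟨fun v => ⟨Pi.single i
          (v (.inl (.inr k)) * D ^ (-m)), ?_⟩, fun j => ?_⟩⟩
        · rw [finiteDepthMatrix_singleton, vecMul_cnot, sum_smul_single_single, join_zero_single]
          congr 1
          rw [Finset.sum_eq_single i]
          · ext t; simp [pauliZ, Pi.single_apply]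
          · intro j _ hj; simp [hj]
          · simp
        · rw [finiteDepthMatrix_singleton, vecMul_cnot]
          simp [pauliZ]
  have : u = ∑ i, ∑ s, Pi.single i (Pi.single s (u i s)) := by
    ext j t
    simp [Finset.sum_apply, -Fintype.sum_sum_type, Pi.single_apply, ite_apply]
  change u ∈ A
  rw [this]
  exact sum_mem fun i _ => sum_mem fun s _ => hA i s _ (hu i s)

end Shear

/-! ### Scaling by infinite-depth operations -/

section Scaling

variable {q : Type} [Fintype q] [DecidableEq q]

/-- Infinite-depth operations multiply the `X` part of the qubits in `B` by a Laurent
polynomial. -/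
theorem exists_circuit_scaling (B : Finset q) (f : K) (hf : IsLaurent f) (hf0 : f ≠ 0) :
    ∃ gs : List (Gate q), ∀ (v : q ⊕ q → K) (s : q ⊕ q), (v ᵥ* circuitMatrix gs) s =
      (if qubit s ∈ B then Sum.elim (fun _ => f⁻¹) (fun _ => bar f) s else 1) * v s := by
  induction B using Finset.induction_on with
  | empty => exact ⟨[], by simp⟩
  | insert i B hi ih =>
    obtain ⟨gs, hgs⟩ := ih
    -- The operation divides the X part by `f`; conjugation by Hadamard moves that division to the Z
    -- part and puts the factor `bar f` on the X part.
    refine ⟨gs ++ [.finiteDepth (.hadamard i), .infiniteDepth i f hf hf0,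
      .finiteDepth (.hadamard i)], fun v s => ?_⟩
    rw [circuitMatrix_append, ← vecMul_vecMul]
    simp only [circuitMatrix_cons, circuitMatrix_nil, Matrix.mul_one, ← vecMul_vecMul]
    have hH : (Gate.finiteDepth (.hadamard i) : Gate q).toMatrix =
      (FiniteDepthGate.hadamard i).toMatrix := rfl
    rw [hH, vecMul_hadamard, vecMul_infiniteDepth, vecMul_hadamard]
    rcases s with j | j <;> by_cases h : j = i
    · subst h; simp [hgs, hi, mul_comm]
    · simp [hgs, h, Equiv.swap_apply_of_ne_of_ne]
    · subst h; simp [hgs, hi, mul_comm]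
    · simp [hgs, h, Equiv.swap_apply_of_ne_of_ne]

end Scaling

/-! ### Normal form of a check matrix -/

section NormalForm

/-- The qubits outside the range become the information qubits; that their number `m` is natural
will give `k + c ≥ 0`. -/
theorem exists_equiv_of_injective {n c a : ℕ} (f : Fin c ⊕ Fin a → Fin n)
    (hf : Function.Injective f) :
    ∃ (m : ℕ) (e : Fin c ⊕ Fin a ⊕ Fin m ≃ Fin n), (∀ i, e (.inl i) = f (.inl i)) ∧
      ∀ j, e (.inr (.inl j)) = f (.inr j) := by
  classical
  let C := {x // x ∈ (Set.range f)ᶜ}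
  refine ⟨Fintype.card C, (Equiv.sumAssoc _ _ _).symm.trans ((Equiv.sumCongr
    (Equiv.ofInjective f hf) (Fintype.equivFin C).symm).trans (Equiv.Set.sumCompl (Set.range f))),
    fun i => ?_, fun j => ?_⟩ <;> simp only [Equiv.trans_apply]
  · exact Equiv.Set.sumCompl_apply_inl _ _
  · exact Equiv.Set.sumCompl_apply_inl _ _

theorem mem_span_pauliZ {q : Type} [Fintype q] [DecidableEq q] {B : Set q} {v : q ⊕ q → K}
    (h : ∀ s, (∀ b ∈ B, s ≠ .inl b) → v s = 0) : v ∈ Submodule.span K (pauliZ '' B) := by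
  have : v = ∑ i, v (.inl i) • pauliZ i := by
    ext (i | i)
    · simp [pauliZ, Finset.sum_apply, Pi.single_apply]
    · simp [pauliZ, Finset.sum_apply, h (.inr i)]
  rw [this]
  refine Submodule.sum_mem _ fun i _ => ?_
  by_cases hi : i ∈ B
  · exact Submodule.smul_mem _ _ (Submodule.subset_span ⟨i, hi, rfl⟩)
  · rw [h (.inl i), zero_smul]
    · exact zero_mem _
    · rintro b hb h
      exact hi (Sum.inl_injective h ▸ hb)

variable {n c a : ℕ}

/-- A finite-depth circuit turns the row space of a check matrix into one that contains the
operators `Z` of ancillas and ebits, and for each ebit a vector whose `X` part on the ebits and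
ancillas is that of the operator `X`. -/
theorem exists_circuit_normal_form (H : Matrix (Gen c a) (Fin n ⊕ Fin n) K)
    (hrank : LinearIndependent K H.row) (hH : shiftedSymplectic H = standardForm c a) :
    ∃ (m : ℕ) (e : Fin c ⊕ Fin a ⊕ Fin m ≃ Fin n) (gs : List (FiniteDepthGate (Fin n)))
      (y : Fin c → Fin n ⊕ Fin n → K),
      let V := Submodule.span K (Set.range fun p => H p ᵥ* finiteDepthMatrix gs)
      (∀ j, pauliZ (e (.inr (.inl j))) ∈ V) ∧ (∀ i, pauliZ (e (.inl i)) ∈ V) ∧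
        ∀ i, y i ∈ V ∧ (∀ i', y i (.inr (e (.inl i'))) = if i = i' then 1 else 0) ∧
          ∀ j, y i (.inr (e (.inr (.inl j)))) = 0 := by
  have hform : ∀ p p', sform (H p) (H p') = standardForm c a p p' := fun p p' => by
    rw [← shiftedSymplectic_apply, hH]
  -- The isotropic half of the rows. The isolated rows come first, so that they alone span the `Z`
  -- of the ancillas.
  let idx : Fin (a + c) → Gen c a := Fin.addCases .inr fun i => .inl (0, i)
  have hidx : Function.Injective idx := by
    intro k k'
    refine Fin.addCases (fun j => ?_) (fun i => ?_) k <;>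
      refine Fin.addCases (fun j' => ?_) (fun i' => ?_) k' <;> simp [idx]
  let u : ℕ → Fin n ⊕ Fin n → K := fun k => if h : k < a + c then H (idx ⟨k, h⟩) else 0
  have hu : ∀ k : Fin (a + c), u k = H (idx k) := fun k => by simp [u]
  have hu_image : ∀ k ≤ a + c, u '' Set.Iio k = H.row '' (idx '' {l | (l : ℕ) < k}) := by
    intro k hk
    ext v
    simp only [Set.mem_image, Set.mem_Iio, Set.mem_ofPred_eq, exists_exists_and_eq_and]
    constructor
    · rintro ⟨l, hl, rfl⟩
      exact ⟨⟨l, by omega⟩, hl, (hu ⟨l, by omega⟩).symm⟩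
    · rintro ⟨l, hl, rfl⟩
      exact ⟨l, hl, hu l⟩
  obtain ⟨gs, L, hL, hlen, hspan⟩ := exists_circuit_prefix u (a + c)
    (by
      intro k hk
      rw [hu_image k hk.le, hu ⟨k, hk⟩]
      refine hrank.notMem_span_image ?_
      rintro ⟨l, hl, hlk⟩
      have : (l : ℕ) < k := hl
      rw [hidx hlk] at this
      exact lt_irrefl _ this)
    (by
      intro k hk k' hk'
      rw [hu ⟨k, hk⟩, hu ⟨k', hk'⟩, hform]
      refine Fin.addCases (fun j => ?_) (fun i => ?_) (⟨k, hk⟩ : Fin (a + c)) <;>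
        refine Fin.addCases (fun j' => ?_) (fun i' => ?_) (⟨k', hk'⟩ : Fin (a + c)) <;>
        simp [idx, standardForm, blockDiagonal_apply])
  let f : Fin c ⊕ Fin a → Fin n := Sum.elim (fun i => L.get (Fin.cast hlen.symm (Fin.natAdd a i)))
    (fun j => L.get (Fin.cast hlen.symm (Fin.castAdd c j)))
  have hf : Function.Injective f := by
    have := List.nodup_iff_injective_get.mp hL
    rintro (i | j) (i' | j') h <;> have h := Fin.ext_iff.mp (this h) <;> simp at h
    · rw [Fin.ext h]
    · omega
    · omega
    · rw [Fin.ext h]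
  obtain ⟨m, e, he₁, he₂⟩ := exists_equiv_of_injective f hf
  set G := finiteDepthMatrix gs with hG
  have hsp : ∀ k ≤ a + c, Submodule.span K ((fun p => H p ᵥ* G) '' (idx '' {l | (l : ℕ) < k})) =
      Submodule.span K (pauliZ '' {b | b ∈ L.take k}) := by
    intro k hk
    rw [← hspan k hk]
    have := congrArg (fun S => (fun v => v ᵥ* G) '' S) (hu_image k hk)
    simp only [Set.image_image] at this
    rw [this, Set.image_image]
    rfl
  set H' : Gen c a → Fin n ⊕ Fin n → K := fun p => H p ᵥ* G with hH'
  have hform' : ∀ p p', sform (H' p) (H' p') = standardForm c a p p' := fun p p' => by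
    rw [hH', hG, sform_vecMul_finiteDepthMatrix, hform]
  have hanc : ∀ j, pauliZ (e (.inr (.inl j))) ∈
      Submodule.span K (H' '' (idx '' {l | (l : ℕ) < a})) := by
    intro j
    rw [hsp a (by omega)]
    refine Submodule.subset_span ⟨_, ?_, rfl⟩
    rw [he₂]
    exact List.mem_take_iff_getElem.mpr ⟨j, by omega, rfl⟩
  have hebit : ∀ i, pauliZ (e (.inl i)) ∈
      Submodule.span K (H' '' (idx '' {l | (l : ℕ) < a + c})) := by
    intro i
    rw [hsp (a + c) le_rfl]
    refine Submodule.subset_span ⟨_, ?_, rfl⟩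
    rw [he₁, List.take_of_length_le hlen.le]
    exact List.get_mem _ _
  have hle : ∀ k, Submodule.span K (H' '' (idx '' {l | (l : ℕ) < k})) ≤
      Submodule.span K (Set.range H') := fun k => Submodule.span_mono (Set.image_subset_range _ _)
  -- The partner rows are orthogonal to the isolated rows, hence to `Z` on each ancilla.
  have hx_anc : ∀ i j, H' (.inl (1, i)) (.inr (e (.inr (.inl j)))) = 0 := by
    intro i j
    have := sform_eq_zero_of_mem_span (w := H' (.inl (1, i))) (by
      rintro _ ⟨_, ⟨l, hl, rfl⟩, rfl⟩
      rw [hform']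
      obtain ⟨j', rfl⟩ : ∃ j', l = Fin.castAdd c j' := ⟨⟨l, hl⟩, rfl⟩
      simp [idx, standardForm]) (hanc j)
    simpa using this
  let N : Matrix (Fin c) (Fin c) K := of fun i j => H' (.inl (1, i)) (.inr (e (.inl j)))
  -- A combination of partner rows killed by `N` has no X part on ebits and ancillas. It is thus
  -- orthogonal to all straightened rows, yet its product with row `(0, i)` recovers its `i`-th
  -- coefficient.
  have hN : IsUnit N.det := by
    rw [← isUnit_iff_isUnit_det, ← vecMul_injective_iff_isUnit]
    refine (injective_iff_map_eq_zero N.vecMulLinear).mpr fun α hα => ?_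
    set w := ∑ i, α i • H' (.inl (1, i)) with hw
    have hw₁ : ∀ i, w (.inr (e (.inl i))) = 0 := fun i => by
      simpa [vecMul, dotProduct, N, hw, Finset.sum_apply] using congrFun hα i
    have hw₂ : ∀ j, w (.inr (e (.inr (.inl j)))) = 0 := fun j => by
      simp [hw, Finset.sum_apply, hx_anc]
    ext i
    have hmem : H' (.inl (0, i)) ∈ Submodule.span K (pauliZ '' {b | b ∈ L}) := by
      have := hsp (a + c) le_rfl
      rw [List.take_of_length_le hlen.le] at this
      rw [← this]
      exact Submodule.subset_span ⟨_, ⟨Fin.natAdd a i, by simp, rfl⟩, by simp [idx]⟩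
    have h0 := sform_eq_zero_of_mem_span (w := w) (by
      rintro _ ⟨b, hb, rfl⟩
      obtain ⟨k, rfl⟩ := List.get_of_mem hb
      obtain ⟨k, rfl⟩ : ∃ k', k = Fin.cast hlen.symm k' := ⟨Fin.cast hlen k, rfl⟩
      rw [sform_pauliZ_left, bar_eq_zero]
      refine Fin.addCases (fun j => ?_) (fun i => ?_) k
      · have := hw₂ j
        rwa [he₂] at this
      · have := hw₁ i
        rwa [he₁] at this) hmem
    rw [← bar_sform, bar_eq_zero, hw] at h0
    rw [← sformLinear_apply, map_sum] at h0
    simpa [hform', standardForm, blockDiagonal_apply] using h0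
  refine ⟨m, e, gs, fun i => ∑ j, N⁻¹ i j • H' (.inl (1, j)), fun j => hle _ (hanc j),
    fun i => hle _ (hebit i), fun i => ⟨?_, fun i' => ?_, fun j => ?_⟩⟩
  · exact Submodule.sum_mem _ fun j _ => Submodule.smul_mem _ _ (Submodule.subset_span ⟨_, rfl⟩)
  · have := congrFun (congrFun (nonsing_inv_mul N hN) i) i'
    simpa [mul_apply, one_apply, N, Finset.sum_apply] using this
  · simp [Finset.sum_apply, hx_anc]

end NormalForm

/-! ### The encoder and the decoder -/

section Main

variable {n c a m : ℕ}

/-- Alice's halves of the ebits and the information qubits. -/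
def aliceEmbedding (e : Fin c ⊕ Fin a ⊕ Fin m ≃ Fin n) : Fin c ⊕ Fin m ↪ Fin n :=
  ((Function.Embedding.refl _).sumMap Function.Embedding.inr).trans e.toEmbedding

/-- Bob's halves of the ebits and the information qubits. -/
def bobEmbedding (e : Fin c ⊕ Fin a ⊕ Fin m ≃ Fin n) : Fin c ⊕ Fin m ↪ Qubits c n :=
  (Function.Embedding.refl _).sumMap
    ((Function.Embedding.inr.trans Function.Embedding.inr).trans e.toEmbedding)

@[simp]
theorem aliceEmbedding_inl (e : Fin c ⊕ Fin a ⊕ Fin m ≃ Fin n) (i : Fin c) :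
    aliceEmbedding e (.inl i) = e (.inl i) := rfl

@[simp]
theorem aliceEmbedding_inr (e : Fin c ⊕ Fin a ⊕ Fin m ≃ Fin n) (k : Fin m) :
    aliceEmbedding e (.inr k) = e (.inr (.inr k)) := rfl

/-- The stabilizer generators before encoding, on Alice's qubits. -/
def aliceStabilizer (e : Fin c ⊕ Fin a ⊕ Fin m ≃ Fin n) :
    Matrix (Gen c a) (Fin n ⊕ Fin n) K :=
  of <| Sum.elim
    (fun p => if p.1 = 0 then pauliZ (e (.inl p.2)) else pauliX (e (.inl p.2)))
    (fun j => pauliZ (e (.inr (.inl j))))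

theorem aliceStabilizer_eq (e : Fin c ⊕ Fin a ⊕ Fin m ≃ Fin n) (p : Gen c a) :
    initialStabilizer e p ∘ Sum.map .inr .inr = aliceStabilizer e p := by
  rcases p with ⟨b, i⟩ | j
  · by_cases hb : b = 0
    · ext (k | k) <;> simp [initialStabilizer, aliceStabilizer, hb, pauliZ, Pi.single_apply]
    · ext (k | k) <;> simp [initialStabilizer, aliceStabilizer, hb, pauliX, Pi.single_apply]
  · ext (k | k) <;> simp [initialStabilizer, aliceStabilizer, pauliZ, Pi.single_apply]

theorem channelPart_eq (e : Fin c ⊕ Fin a ⊕ Fin m ≃ Fin n) (enc : List (Gate (Fin n))) :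
    channelPart (initialStabilizer e * encoderMatrix c enc) =
      aliceStabilizer e * circuitMatrix enc := by
  ext p s
  have := (vecMul_map_circuit Function.Embedding.inr enc (initialStabilizer e p)).1
  have h := congrFun this s
  rw [show (initialStabilizer e p) ∘ Sum.map Function.Embedding.inr Function.Embedding.inr =
    aliceStabilizer e p from aliceStabilizer_eq e p] at h
  exact h

theorem linearIndependent_aliceStabilizer (e : Fin c ⊕ Fin a ⊕ Fin m ≃ Fin n) :
    LinearIndependent K (aliceStabilizer e).row := by
  let f : Gen c a → Fin n ⊕ Fin n := Sum.elim
    (fun p => if p.1 = 0 then .inl (e (.inl p.2)) else .inr (e (.inl p.2)))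
    (fun j => .inl (e (.inr (.inl j))))
  have hf : Function.Injective f := by
    rintro (⟨b, i⟩ | j) (⟨b', i'⟩ | j') h
    · fin_cases b <;> fin_cases b' <;> simp_all [f]
    · fin_cases b <;> simp_all [f]
    · fin_cases b' <;> simp_all [f]
    · simp_all [f]
  have : (aliceStabilizer e).row = (fun s => Pi.single s 1) ∘ f := by
    ext p s
    rcases p with ⟨b, i⟩ | j
    · by_cases hb : b = 0 <;> simp [aliceStabilizer, f, hb, pauliZ, pauliX]
    · simp [aliceStabilizer, f, pauliZ]
  rw [this]
  exact (Pi.linearIndependent_single_one (Fin n ⊕ Fin n) K).comp f hf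

theorem isUnit_det_gate {q : Type} [Fintype q] [DecidableEq q] (g : Gate q) :
    IsUnit g.toMatrix.det := by
  cases g with
  | finiteDepth g =>
    have := congrArg det (gate_mul_self g)
    rw [det_mul, det_one] at this
    exact IsUnit.of_mul_eq_one _ this
  | infiniteDepth i f hf hf0 =>
    simp only [Gate.toMatrix, det_diagonal, isUnit_iff_ne_zero, Finset.prod_ne_zero_iff]
    rintro (j | j) - <;> by_cases h : j = i <;> simp [h, hf0]

theorem isUnit_det_circuitMatrix {q : Type} [Fintype q] [DecidableEq q] (gs : List (Gate q)) :
    IsUnit (circuitMatrix gs).det := by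
  induction gs with
  | nil => simp
  | cons g gs ih => rw [circuitMatrix_cons, det_mul]; exact (isUnit_det_gate g).mul ih

/-- An independent family in the row space of a matrix of the same size is row equivalent
to it. -/
theorem rowEquivalent_of_mem_span {r q : Type} [Fintype r] [DecidableEq r] [Fintype q]
    [DecidableEq q] {A B : Matrix r (q ⊕ q) K} (hA : LinearIndependent K A.row)
    (h : ∀ p, A p ∈ Submodule.span K (Set.range B.row)) : RowEquivalent A B := by
  choose R hR using fun p => (Submodule.mem_span_range_iff_exists_fun K).mp (h p)
  have hAB : A = of R * B := by
    ext p s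
    rw [← hR p]
    simp [mul_apply, Finset.sum_apply]
  refine ⟨of R, ?_, hAB⟩
  rw [← isUnit_iff_isUnit_det, ← vecMul_injective_iff_isUnit]
  have hinj := vecMul_injective_iff.mpr hA
  intro x y hxy
  apply hinj
  have hxy : x ᵥ* of R = y ᵥ* of R := hxy
  simp only [hAB, ← vecMul_vecMul, hxy]

/-- Only `V` matters for the code, so each `y i` need be reproduced only up to a nonzero factor and
up to `Z` on ebits and ancillas. This freedom allows a finite-depth shear, and leaves the
information qubits untouched by the infinite-depth part. -/
theorem exists_encoder_decoder (e : Fin c ⊕ Fin a ⊕ Fin m ≃ Fin n)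
    (gs : List (FiniteDepthGate (Fin n))) (V : Submodule K (Fin n ⊕ Fin n → K))
    (hanc : ∀ j, pauliZ (e (.inr (.inl j))) ∈ V) (hebit : ∀ i, pauliZ (e (.inl i)) ∈ V)
    (y : Fin c → Fin n ⊕ Fin n → K) (hyV : ∀ i, y i ∈ V)
    (hy₁ : ∀ i i', y i (.inr (e (.inl i'))) = if i = i' then 1 else 0)
    (hy₂ : ∀ i j, y i (.inr (e (.inr (.inl j)))) = 0) :
    ∃ (enc : List (Gate (Fin n))) (dec : List (FiniteDepthGate (Qubits c n))),
      (∀ p, (aliceStabilizer e * circuitMatrix enc) p ∈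
        V.map (finiteDepthMatrix gs.reverse).vecMulLinear) ∧
      Decodes e (encoderMatrix c enc) (decoderMatrix dec) := by
  set εA := aliceEmbedding e with hεA
  set εB := bobEmbedding e with hεB
  let u : Fin c → Fin m ⊕ Fin m → K := fun i s => y i (Sum.map (εA ∘ .inr) (εA ∘ .inr) s)
  obtain ⟨h, hh0, hhL, hhu⟩ :=
    exists_common_denominator fun p : Fin c × (Fin m ⊕ Fin m) => u p.1 p.2
  obtain ⟨ts, hts⟩ := exists_circuit_isShear (fun i => h • u i) fun i s => hhu (i, s)
  -- The parameter is `bar h` because scaling multiplies `X` by the conjugate of its parameter; `X`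
  -- must receive `h` itself, to match the tail `h • u i`.
  obtain ⟨ss, hss⟩ := exists_circuit_scaling (Finset.univ.map
    (Function.Embedding.inl.trans e.toEmbedding)) (bar h) hhL.bar (by simpa using hh0)
  have hmemB : ∀ k, k ∈ Finset.univ.map (Function.Embedding.inl.trans e.toEmbedding) ↔
      ∃ i, e (.inl i) = k := fun k => by simp
  simp only [hmemB, bar_bar] at hss
  set T := finiteDepthMatrix ts with hT
  set S := circuitMatrix ss with hS
  set G' := finiteDepthMatrix gs.reverse with hG'
  let enc : List (Gate (Fin n)) := (ts.map (FiniteDepthGate.map εA)).map .finiteDepth ++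
    (ss ++ gs.reverse.map .finiteDepth)
  -- The shear is undone with Bob's halves as controls (`εB`) in place of Alice's (`εA`).
  let dec : List (FiniteDepthGate (Qubits c n)) :=
    gs.map (FiniteDepthGate.map .inr) ++ (ts.map (FiniteDepthGate.map εB)).reverse
  have henc : ∀ v, v ᵥ* circuitMatrix enc =
      v ᵥ* finiteDepthMatrix (ts.map (FiniteDepthGate.map εA)) ᵥ* S ᵥ* G' := fun v => by
    simp only [enc, circuitMatrix_append, vecMul_vecMul, Matrix.mul_assoc]
    rfl
  have hZ_T : ∀ i, pauliZ (e (.inl i)) ᵥ* finiteDepthMatrix (ts.map (FiniteDepthGate.map εA)) =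
      pauliZ (e (.inl i)) := fun i => by
    have := push_vecMul_finiteDepth εA ts (pauliZ (.inl i))
    rwa [hts.vecMul_pauliZ, push_pauliZ] at this
  refine ⟨enc, dec, fun p => ?_, ?_⟩
  · refine ⟨aliceStabilizer e p ᵥ* finiteDepthMatrix (ts.map (FiniteDepthGate.map εA)) ᵥ* S,
      ?_, (henc _).symm⟩
    rcases p with ⟨b, i⟩ | j
    · by_cases hb : b = 0
      · subst hb
        have h1 : aliceStabilizer e (.inl (0, i)) = pauliZ (e (.inl i)) := rfl
        rw [h1, hZ_T]
        have : pauliZ (e (.inl i)) ᵥ* S = (bar h)⁻¹ • pauliZ (e (.inl i)) := by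
          ext s
          rw [hss]
          rcases s with k | k
          · by_cases hk : k = e (.inl i)
            · subst hk; simp [pauliZ]
            · simp [pauliZ, hk]
          · simp [pauliZ]
        rw [this]
        exact V.smul_mem _ (hebit i)
      · have h1 : aliceStabilizer e (.inl (b, i)) = pauliX (e (.inl i)) := if_neg hb
        rw [h1]
        set w := pauliX (e (.inl i)) ᵥ* finiteDepthMatrix (ts.map (FiniteDepthGate.map εA)) ᵥ* S
          with hw
        have hpush := push_vecMul_finiteDepth εA ts (pauliX (.inl i))
        rw [push_pauliX] at hpush
        obtain ⟨z, hz⟩ := hts.vecMul_eq (pauliX (.inl i))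
        have hsum : ∑ j, (pauliX (.inl i) : (Fin c ⊕ Fin m) ⊕ (Fin c ⊕ Fin m) → K) (.inr (.inl j)) •
            (h • u j) = h • u i := by
          rw [Finset.sum_eq_single i]
          · simp [pauliX]
          · intro j _ hj; simp [pauliX, hj]
          · simp
        rw [hsum] at hz
        -- Agreement is needed only away from the Z entries on ebits and ancillas; this also absorbs
        -- the unknown back-action of the shear.
        have hdiff : w - h • y i ∈ Submodule.span K
            (pauliZ '' {k | (∃ i, e (.inl i) = k) ∨ ∃ j, e (.inr (.inl j)) = k}) := by
          refine mem_span_pauliZ fun s hs => ?_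
          have hws : ∀ s, w s = _ := fun s => by rw [hw, hss, ← aliceEmbedding_inl, ← hεA, hpush]
          rw [Pi.sub_apply, hws, sub_eq_zero]
          have hpc : ∀ s, push εA (pauliX (.inl i) ᵥ* finiteDepthMatrix ts) (Sum.map εA εA s) = _ :=
            fun s => congrFun (push_comp εA _) s
          rcases s with k | k <;> obtain ⟨k, rfl⟩ := e.surjective k <;> rcases k with i' | j | k
          · exact absurd rfl (hs _ (.inl ⟨i', rfl⟩))
          · exact absurd rfl (hs _ (.inr ⟨j, rfl⟩))
          · have := hpc (.inl (.inr k))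
            simp only [Sum.map_inl, hεA, aliceEmbedding_inr] at this
            rw [this, ← hT, hz]
            simp [pauliX, pauliZ, join, Finset.sum_apply, u, hεA]
          · have := hpc (.inr (.inl i'))
            simp only [Sum.map_inr, hεA, aliceEmbedding_inl] at this
            rw [this, ← hT, hz]
            simp [pauliX, pauliZ, join, Finset.sum_apply, hy₁, Pi.single_apply, eq_comm]
          · rw [push_apply_of_notMem]
            · simp [hy₂]
            · rintro ⟨(k | k) | (k | k), hk⟩ <;> simp [hεA] at hk
          · have := hpc (.inr (.inr k))
            simp only [Sum.map_inr, hεA, aliceEmbedding_inr] at this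
            rw [this, ← hT, hz]
            simp [pauliX, pauliZ, join, Finset.sum_apply, u, hεA]
        have hspan : Submodule.span K
            (pauliZ '' {k | (∃ i, e (.inl i) = k) ∨ ∃ j, e (.inr (.inl j)) = k}) ≤ V := by
          rw [Submodule.span_le]
          rintro _ ⟨_, (⟨i, rfl⟩ | ⟨j, rfl⟩), rfl⟩
          exacts [hebit i, hanc j]
        have := V.add_mem (hspan hdiff) (V.smul_mem h (hyV i))
        rwa [sub_add_cancel] at this
    · have h1 : aliceStabilizer e (.inr j) = pauliZ (e (.inr (.inl j))) := rfl
      rw [h1, vecMul_finiteDepth_of_comp_eq_zero]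
      · have : pauliZ (e (.inr (.inl j))) ᵥ* S = pauliZ (e (.inr (.inl j))) := by
          ext s
          rw [hss]
          rcases s with k | k
          · by_cases hk : k = e (.inr (.inl j))
            · subst hk; simp [pauliZ]
            · simp [pauliZ, hk]
          · simp [pauliZ]
        rw [this]
        exact hanc j
      · ext ((k | k) | (k | k)) <;> simp [pauliZ, hεA]
  · let lam : Fin 2 × Fin m → (Fin c ⊕ Fin m) ⊕ (Fin c ⊕ Fin m) → K := fun p =>
      if p.1 = 0 then pauliZ (.inr p.2) else pauliX (.inr p.2)
    have hlamx : ∀ p i, lam p (.inr (.inl i)) = 0 := by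
      intro p i
      by_cases hp : p.1 = 0 <;> simp [lam, hp, pauliZ, pauliX]
    -- Information operators have no X part on the controls, so the shear changes them only by its
    -- back-action, `Z` on ebits.
    have hlam : ∀ p, lam p ᵥ* T =
        lam p + ∑ i, (lam p ᵥ* T) (.inl (.inl i)) • pauliZ (.inl i) := by
      intro p
      obtain ⟨z, hz⟩ := hts.vecMul_eq (lam p)
      have hj : join (0 : Fin c ⊕ Fin c → K) (∑ i, lam p (.inr (.inl i)) • h • u i) = 0 := by
        simp only [hlamx, zero_smul, Finset.sum_const_zero]
        ext ((k | k) | (k | k)) <;> rfl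
      rw [hj, add_zero] at hz
      have hzi : ∀ i, (lam p ᵥ* T) (.inl (.inl i)) = z i := by
        intro i
        rw [hz]
        by_cases hp : p.1 = 0 <;>
          simp [lam, hp, pauliZ, pauliX, Finset.sum_apply, Pi.single_apply]
      simp only [hzi]
      exact hz
    set A : Matrix (Fin 2 × Fin m) (Fin c) K := of fun p i => (lam p ᵥ* T) (.inl (.inl i)) with hA
    have hAL : ∀ p i, IsLaurent (A p i) := by
      intro p i
      change IsLaurent (∑ s, lam p s * T s (.inl (.inl i)))
      refine .sum fun s _ => IsLaurent.mul ?_ (isLaurent_finiteDepthMatrix _ _ _)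
      by_cases hp : p.1 = 0 <;> simp only [lam, hp, pauliZ, pauliX, if_true, if_false,
        Pi.single_apply] <;> split_ifs <;> first | exact .one | exact .zero
    -- Only the generators `Z ⊗ Z` are needed, with the back-action as coefficients; these are
    -- Laurent polynomials because the shear is finite-depth.
    let Q : Matrix (Fin 2 × Fin m) (Gen c a) K :=
      of fun p => Sum.elim (fun r => if r.1 = 0 then A p r.2 else 0) 0
    refine ⟨Q, ?_, ?_⟩
    · rintro p (⟨b, i⟩ | j)
      · by_cases hb : b = 0 <;> simp only [Q, of_apply, Sum.elim_inl, hb, if_true, if_false]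
        · exact hAL p i
        · exact .zero
      · exact .zero
    · have hE : ∀ v, push .inr v ᵥ* encoderMatrix c enc = push .inr (v ᵥ* circuitMatrix enc) :=
        fun v => push_vecMul_circuit _ _ v
      have hF : decoderMatrix dec = finiteDepthMatrix (gs.map (FiniteDepthGate.map .inr)) *
          finiteDepthMatrix (ts.map (FiniteDepthGate.map εB)).reverse :=
        finiteDepthMatrix_append _ _
      have hinfo : ∀ p, initialInfo e p = push .inr (push εA (lam p)) := by
        intro p
        by_cases hp : p.1 = 0
        · simp only [lam, hp, if_true, push_pauliZ]; exact if_pos hp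
        · simp only [lam, hp, if_false, push_pauliX]; exact if_neg hp
      have hinfo' : ∀ p, push .inr (push εA (lam p)) = push εB (lam p) := by
        intro p
        by_cases hp : p.1 = 0
        · simp only [lam, hp, if_true, push_pauliZ]; rfl
        · simp only [lam, hp, if_false, push_pauliX]; rfl
      have hstab : ∀ i, initialStabilizer e (.inl (0, i)) =
          pauliZ (.inl i) + push .inr (pauliZ (e (.inl i))) := fun i => by
        rw [push_pauliZ]
        rfl
      have hbob : ∀ i (gs : List (Gate (Fin n))), (pauliZ (.inl i) : Qubits c n ⊕ Qubits c n → K) ᵥ*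
          circuitMatrix (gs.map (Gate.map .inr)) = pauliZ (.inl i) := fun i gs => by
        refine vecMul_circuit_of_comp_eq_zero _ _ ?_
        ext (k | k) <;> simp [pauliZ]
      have hbob' : ∀ i, (pauliZ (.inl i) : Qubits c n ⊕ Qubits c n → K) ᵥ*
          finiteDepthMatrix (gs.map (FiniteDepthGate.map .inr)) = pauliZ (.inl i) := fun i => by
        refine vecMul_finiteDepth_of_comp_eq_zero _ _ ?_
        ext (k | k) <;> simp [pauliZ]
      have hlamS : ∀ p, push εA (lam p) ᵥ* S = push εA (lam p) := by
        intro p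
        ext s
        rw [hss]
        split_ifs with hs
        · obtain ⟨i, hi⟩ := hs
          have : push εA (lam p) s = 0 := by
            by_cases hp : p.1 = 0 <;>
              simp only [lam, hp, if_true, if_false, pauliZ, pauliX, push_single] <;>
              rw [Pi.single_eq_of_ne] <;> rintro rfl <;> simp [hεA] at hi
          rw [this, mul_zero]
        · rw [one_mul]
      have hAlice : ∀ p, push εA (lam p) ᵥ* circuitMatrix enc = push εA (lam p) ᵥ* G' +
          ∑ i, A p i • (pauliZ (e (.inl i)) ᵥ* circuitMatrix enc) := by
        intro p
        rw [henc, push_vecMul_finiteDepth, ← hT, hlam, map_add, map_sum, add_vecMul, add_vecMul,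
          hlamS]
        congr 1
        rw [sum_vecMul, sum_vecMul]
        refine Finset.sum_congr rfl fun i _ => ?_
        rw [map_smul, push_pauliZ, smul_vecMul, smul_vecMul, henc, hZ_T]
        rfl
      -- Alice's factors cancel in characteristic 2 whatever the scaling did to them, and the
      -- unscaled `Z` on Bob's halves remain.
      have hsum : ∀ p, initialInfo e p ᵥ* encoderMatrix c enc +
          ∑ i, A p i • (initialStabilizer e (.inl (0, i)) ᵥ* encoderMatrix c enc) =
          push .inr (push εA (lam p) ᵥ* G') + ∑ i, A p i • pauliZ (.inl i) := by
        intro p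
        have : ∀ i, initialStabilizer e (.inl (0, i)) ᵥ* encoderMatrix c enc =
            pauliZ (.inl i) + push .inr (pauliZ (e (.inl i)) ᵥ* circuitMatrix enc) := fun i => by
          rw [hstab, add_vecMul, hE, encoderMatrix, hbob]
        simp only [this, smul_add, Finset.sum_add_distrib]
        rw [hinfo, hE, hAlice, map_add, map_sum]
        simp only [map_smul]
        generalize ∑ i, A p i • push .inr (pauliZ (e (.inl i)) ᵥ* circuitMatrix enc) = t
        have ht : t + t = 0 := by
          ext s
          exact add_self _
        rw [add_comm (∑ i, A p i • pauliZ (.inl i)) t, add_assoc, ← add_assoc t, ht, zero_add]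
      have hdec : ∀ p, (push .inr (push εA (lam p) ᵥ* G') + ∑ i, A p i • pauliZ (.inl i)) ᵥ*
          decoderMatrix dec = initialInfo e p := by
        intro p
        have h1 : (∑ i, A p i • (pauliZ (.inl i) : Qubits c n ⊕ Qubits c n → K)) ᵥ*
            finiteDepthMatrix (gs.map (FiniteDepthGate.map .inr)) =
            ∑ i, A p i • pauliZ (.inl i) := by
          rw [sum_vecMul]
          exact Finset.sum_congr rfl fun i _ => by rw [smul_vecMul, hbob']
        -- The result is precisely the information operator sheared with Bob's halves as controls.
        have h2 : push εB (lam p) + ∑ i, A p i • pauliZ (.inl i) = push εB (lam p ᵥ* T) := by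
          rw [hlam, map_add, map_sum]
          simp only [map_smul, push_pauliZ]
          rfl
        rw [hF, ← vecMul_vecMul, add_vecMul, push_vecMul_finiteDepth, h1, vecMul_vecMul, hG',
          finiteDepthMatrix_reverse_mul, vecMul_one, hinfo', h2, hT, ← push_vecMul_finiteDepth,
          vecMul_vecMul, finiteDepthMatrix_mul_reverse, vecMul_one, hinfo, hinfo']
      refine funext fun p => ?_
      change (initialInfo e * encoderMatrix c enc * decoderMatrix dec) p =
        initialInfo e p + (Q * (initialStabilizer e * encoderMatrix c enc * decoderMatrix dec)) p
      have hrow := hdec p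
      rw [← hsum, add_vecMul, sum_vecMul] at hrow
      simp only [smul_vecMul] at hrow
      have hQ : (Q *
          (initialStabilizer e * encoderMatrix c enc * decoderMatrix dec)) p =
          ∑ i, A p i • (initialStabilizer e (.inl (0, i)) ᵥ* encoderMatrix c enc) ᵥ*
            decoderMatrix dec := by
        ext s
        simp [Q, mul_apply (M := of _), Fintype.sum_prod_type, Finset.sum_apply,
          mul_apply_eq_vecMul]
      rw [hQ, mul_apply_eq_vecMul, mul_apply_eq_vecMul]
      ext s
      have hs := congrFun hrow s
      rw [Pi.add_apply] at hs ⊢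
      linear_combination hs - add_self ((∑ i, A p i •
        (initialStabilizer e (.inl (0, i)) ᵥ* encoderMatrix c enc) ᵥ* decoderMatrix dec) s)

end Main

end EAQCC

end

/-! ### Assembly of the main theorem -/

theorem theorem1 (n c a : ℕ) (k : ℤ) (hk : (n : ℤ) - k = 2 * c + a)
    (H : Matrix (EAQCC.Gen c a) (Fin n ⊕ Fin n) EAQCC.K)
    (hrank : LinearIndependent EAQCC.K H.row)
    (hH : EAQCC.shiftedSymplectic H = EAQCC.standardForm c a) :
    ∃ (m : ℕ) (e : Fin c ⊕ Fin a ⊕ Fin m ≃ Fin n)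
      (enc : List (EAQCC.Gate (Fin n)))
      (dec : List (EAQCC.FiniteDepthGate (EAQCC.Qubits c n))),
      (m : ℤ) = k + c ∧
      EAQCC.IsOnline (EAQCC.circuitMatrix enc) ∧
      EAQCC.IsOnline (EAQCC.decoderMatrix dec) ∧
      EAQCC.RowEquivalent
        (EAQCC.channelPart (EAQCC.initialStabilizer e * EAQCC.encoderMatrix c enc)) H ∧
      EAQCC.Decodes e (EAQCC.encoderMatrix c enc) (EAQCC.decoderMatrix dec) := by
  obtain ⟨m, e, gs, y, hanc, hebit, hy⟩ := EAQCC.exists_circuit_normal_form H hrank hH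
  obtain ⟨enc, dec, hrow, hdec⟩ := EAQCC.exists_encoder_decoder e gs _ hanc hebit y
    (fun i => (hy i).1) (fun i => (hy i).2.1) (fun i => (hy i).2.2)
  refine ⟨m, e, enc, dec, ?_, EAQCC.isOnline_circuitMatrix _, EAQCC.isOnline_circuitMatrix _, ?_,
    hdec⟩
  · have := Fintype.card_congr e
    simp only [Fintype.card_sum, Fintype.card_fin] at this
    omega
  · rw [EAQCC.channelPart_eq]
    refine EAQCC.rowEquivalent_of_mem_span ?_ fun p => ?_
    · have hinj := Matrix.vecMul_injective_iff_isUnit.mpr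
        ((Matrix.isUnit_iff_isUnit_det _).mpr (EAQCC.isUnit_det_circuitMatrix enc))
      exact (EAQCC.linearIndependent_aliceStabilizer e).map'
        (EAQCC.circuitMatrix enc).vecMulLinear (LinearMap.ker_eq_bot.mpr hinj)
    · have h := hrow p
      -- The space `V` is the row space of `H` after `gs`, so the reversed circuit carries it back
      -- to the row space of `H`.
      rw [Submodule.map_span, ← Set.range_comp] at h
      convert h using 3
      ext q s
      simp [EAQCC.finiteDepthMatrix_mul_reverse]
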